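/- For a positive integer $n$ write $\lg n := \lceil \log_2 n\rceil$ if $n \ge 2$, and $\lg 1 := 1$. Let $q \ge 2$ be an integer, let $m$ be a power of two (possibly $m = 1$) with $$ m \le \frac{\log_2 q}{(\lg \lg q)^2}, $$ and let $\theta \in \mathbb{Z}/q\mathbb{Z}$ satisfy $\theta^m = -1$. For $F = F_0 + F_1 y + \cdots + F_{m-1} y^{m-1} \in \mathbb{Z}[y]/(y^m+1)$ put $\|F\| := \max_i |F_i|$. Then there is a nonzero $P \in \mathbb{Z}[y]/(y^m+1)$ with $$ P(\theta) \equiv 0 \pmod q \qquad\text{and}\qquad \|P\| \le q^{1/m}, $$ and such a $P$ can be computed in $q^{1+o(1)}$ bit operations. That is, there are a single deterministic Turing machine with a fixed finite number of tapes and a function $\varepsilon \colon \mathbb{N} \to \mathbb{R}$ with $\varepsilon(q) \to 0$ as $q \to \infty$ such that, for all $q, m, \theta$ as above, the machine, given $q$, $m$ and the residue of $\theta$ in $\{0,\dots,q-1\}$ in binary, halts after at most $q^{1+\varepsilon(q)}$ steps and outputs the list of coefficients of such a $P$ in binary. -/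

import Mathlib

open Polynomial Filter Topology

/-- `lg n = ⌈log₂ n⌉` for `n ≥ 2`, and `lg 1 = 1`. -/
noncomputable def lg (n : ℕ) : ℕ :=
  if n = 1 then 1 else ⌈Real.logb 2 (n : ℝ)⌉₊

/-- The ring `ℤ[y]/(y ^ m + 1)`. -/
abbrev NegacyclicRing (m : ℕ) : Type :=
  AdjoinRoot (X ^ m + 1 : ℤ[X])

theorem monic_X_pow_add_one_int (m : ℕ) [NeZero m] : (X ^ m + 1 : ℤ[X]).Monic := by
  simpa using monic_X_pow_add_C (1 : ℤ) (NeZero.ne m)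

namespace NegacyclicRing

/-- The coefficient `F_i` of `F = F_0 + F_1 y + ⋯ + F_{m-1} y ^ (m-1)`, that is, of the unique
representative of `F` of degree less than `m`. -/
noncomputable def coeff {m : ℕ} [NeZero m] (F : NegacyclicRing m) (i : ℕ) : ℤ :=
  (AdjoinRoot.modByMonicHom (monic_X_pow_add_one_int m) F).coeff i

/-- The norm `‖F‖ = max_i |F_i|`. -/
noncomputable def maxNorm {m : ℕ} [NeZero m] (F : NegacyclicRing m) : ℕ :=
  (Finset.range m).sup fun i => (F.coeff i).natAbs

/-- Evaluation `F ↦ F(θ)` modulo `q`, at an element `θ` of `ℤ/qℤ` with `θ ^ m = -1`. -/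
noncomputable def evalAt {m q : ℕ} (θ : ZMod q) (hθ : θ ^ m = -1) :
    NegacyclicRing m →+* ZMod q :=
  AdjoinRoot.lift (Int.castRingHom (ZMod q)) θ (by simp [hθ])

end NegacyclicRing

/-! ### Encodings over the alphabet consisting of two bits and an end marker -/

/-- A natural number in binary, least significant bit first, followed by the end marker. -/
def encodeNatBin (n : ℕ) : List (Option Bool) :=
  n.bits.map some ++ [none]

/-- An integer: the sign bit (`true` for negative), followed by the absolute value in binary. -/
def encodeIntBin (z : ℤ) : List (Option Bool) :=
  some (decide (z < 0)) :: encodeNatBin z.natAbs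

/-- The input `(q, m, θ)`, with `θ` given by its residue in `{0, …, q - 1}`. -/
def encodeInput (q m : ℕ) (θ : ZMod q) : List (Option Bool) :=
  encodeNatBin q ++ encodeNatBin m ++ encodeNatBin θ.val

/-- An element of `ℤ[y]/(y ^ m + 1)`, as the list of its `m` coefficients. -/
noncomputable def encodeElem {m : ℕ} [NeZero m] (F : NegacyclicRing m) : List (Option Bool) :=
  (List.range m).flatMap fun i => encodeIntBin (F.coeff i)

/-! ### Bit operations -/

/-- A deterministic Turing machine with a fixed finite number of tapes, reading and writing words
over the alphabet `A`. The underlying model is Mathlib's `Turing.FinTM2`, in which the tapes are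
pushdown tapes (an ordinary tape is a pair of those, the cells to the left of the head and the
others, and a move of the head takes a bounded number of operations). The alphabet of every
tape is required to be finite. -/
structure TapeMachine (A : Type) extends Turing.TM2ComputableAux A A where
  finite_alphabet : ∀ k : tm.K, Finite (tm.Γ k)

/-- On input `x`, the machine `M` halts with output `y` after at most `t` steps. -/
def TapeMachine.OutputsWithin {A : Type} (M : TapeMachine A) (x y : List A) (t : ℕ) : Prop :=
  Nonempty (Turing.TM2OutputsInTime M.tm (x.map M.inputAlphabet.symm)
    (some (y.map M.outputAlphabet.symm)) t)

/-! Write `m = 2 ^ k` and let `B` be the integer part of `q ^ (1 / m)`. There are `(B + 1) ^ m > q`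
vectors with `m` entries in `{0, …, B}`, so two of them, read as coefficient lists, have the same
value at `θ` modulo `q`. Their difference is a nonzero vector with entries of absolute value at most
`B`, and this is the required `P` (`exists_short_list`). The relation `θ ^ m = -1` only makes
evaluation at `θ` well defined on the quotient ring.

The algorithm is exhaustive search. A coefficient is coded by a sign bit and as many bits as `B`
has, so a candidate is a natural number with `m` such blocks. Since `2 ^ B.size ≤ 2 * B`, some
number up to `(4 * B) ^ m ≤ 4 ^ m * q` codes a solution (`exists_decode_eq`, `exists_isSolution`).
Every number decodes to a vector with entries at most `B`, so the search may stop at any candidate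
that is nonzero and vanishes at `θ`. Testing one by Horner's rule costs a power of `log q`. The
hypothesis on `m` gives `4 ^ m ≤ q ^ (2 / (lg lg q) ^ 2) = q ^ o(1)`, which absorbs the loss in the
coding (`four_pow_mul_size_le`). Because `m` is a power of two, `B` is obtained by `k` integer
square roots.

The rest is an implementation with certified time bounds. Programs are finite control graphs over
stacks, closed under sequencing and iteration; `Frag.Exec` records their effect together with a time
bound, and `Exec.bind`, `Exec.iter_next` and `Exec.iter_exit` make the bounds compose. Each
instruction becomes one step of a `Turing.FinTM2` (`Exec.outputsWithin`). On top of this come binary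
arithmetic, registers, arithmetic modulo `q` and the search loop, summed up in `Program.exec_main`.
-/

/-! ### Structured programs for stack machines -/

/-- An instruction of a stack machine with stacks indexed by `K`, stack alphabet `A` and
labels `L`. -/
inductive Instr (K A L : Type) : Type
  | push (k : K) (a : A) (next : L)
  | pop (k : K) (next : Option A → L)
  | jump (next : L)

namespace Instr

variable {K A L L' : Type}

/-- Rename the labels of an instruction. -/
def map (g : L → L') : Instr K A L → Instr K A L'
  | push k a n => push k a (g n)
  | pop k n => pop k fun o => g (n o)
  | jump n => jump (g n)

/-- Execute an instruction: the next label, and the new contents of the stacks. -/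
def run [DecidableEq K] : Instr K A L → (K → List A) → L × (K → List A)
  | push k a n, S => (n, Function.update S k (a :: S k))
  | pop k n, S => (n (S k).head?, Function.update S k (S k).tail)
  | jump n, S => (n, S)

theorem run_map [DecidableEq K] (g : L → L') (i : Instr K A L) (S : K → List A) :
    (i.map g).run S = (g (i.run S).1, (i.run S).2) := by
  cases i <;> rfl

end Instr

/-- A program fragment with exits indexed by `E`. -/
structure Frag (K A E : Type) : Type 1 where
  /-- The labels of the fragment. -/
  Label : Type
  finite_label : Finite Label
  /-- The label at which the execution starts. -/
  entry : Label
  /-- The instruction at each label, which leads to a label or to an exit. -/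
  code : Label → Instr K A (Label ⊕ E)

namespace Frag

variable {K A E E' C : Type}

/-- The fragment that does nothing. -/
def ret (e : E) : Frag K A E where
  Label := Unit
  finite_label := inferInstance
  entry := ()
  code _ := .jump (.inr e)

/-- Push a symbol onto a stack. -/
def push (k : K) (a : A) : Frag K A Unit where
  Label := Unit
  finite_label := inferInstance
  entry := ()
  code _ := .push k a (.inr ())

/-- Pop a symbol from a stack; the exit tells the symbol. -/
def pop (k : K) : Frag K A (Option A) where
  Label := Unit
  finite_label := inferInstance
  entry := ()
  code _ := .pop k .inr

/-- Sequential composition: after the exit `e` of `F` continue with `G e`. -/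
def bind [Finite E] (F : Frag K A E) (G : E → Frag K A E') : Frag K A E' where
  Label := F.Label ⊕ Σ e, (G e).Label
  finite_label :=
    have := F.finite_label
    have := fun e => (G e).finite_label
    inferInstance
  entry := .inl F.entry
  code
    | .inl l => (F.code l).map (Sum.elim (fun l => .inl (.inl l))
        fun e => .inl (.inr ⟨e, (G e).entry⟩))
    | .inr ⟨e, l⟩ => ((G e).code l).map (Sum.elim (fun l => .inl (.inr ⟨e, l⟩)) .inr)

/-- Iterate `F`, which takes a parameter and tells whether to go on (with which parameter)
or to exit. -/
def iter [Finite C] (F : C → Frag K A (C ⊕ E)) (c : C) : Frag K A E where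
  Label := Σ c, (F c).Label
  finite_label :=
    have := fun c => (F c).finite_label
    inferInstance
  entry := ⟨c, (F c).entry⟩
  code l := ((F l.1).code l.2).map (Sum.elim (fun l' => .inl ⟨l.1, l'⟩)
    (Sum.elim (fun c' => .inl ⟨c', (F c').entry⟩) .inr))

section Semantics

variable [DecidableEq K]

/-- A step of the execution of a fragment. -/
def step (F : Frag K A E) : (F.Label ⊕ E) × (K → List A) → (F.Label ⊕ E) × (K → List A)
  | (.inl l, S) => (F.code l).run S
  | (.inr e, S) => (.inr e, S)

/-- Started on the stacks `S`, the fragment `F` leaves through the exit `e` with the stacks `S'`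
after at most `t` steps. -/
def Exec (F : Frag K A E) (S : K → List A) (e : E) (S' : K → List A) (t : ℕ) : Prop :=
  F.step^[t] (.inl F.entry, S) = (.inr e, S')

/-- Exits are absorbing. This is what lets `Exec`, an equation about exactly `t` iterations, serve
as an upper bound for the time. -/
theorem iterate_step_inr (F : Frag K A E) (e : E) (S : K → List A) (t : ℕ) :
    F.step^[t] (.inr e, S) = (.inr e, S) :=
  Function.iterate_fixed rfl t

theorem Exec.mono {F : Frag K A E} {S S' : K → List A} {e : E} {t t' : ℕ}
    (h : F.Exec S e S' t) (htt : t ≤ t') : F.Exec S e S' t' := by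
  obtain ⟨d, rfl⟩ := Nat.exists_eq_add_of_le htt
  rw [Exec, Nat.add_comm, Function.iterate_add_apply, h, iterate_step_inr]

theorem Exec.congr_result {F : Frag K A E} {S S' S'' : K → List A} {e : E} {t : ℕ}
    (h : F.Exec S e S' t) (hS : S' = S'') : F.Exec S e S'' t :=
  hS ▸ h

/-- Simulation principle behind both `bind` and `iter`: if the code of `F` sits inside `H`, with
exits redirected by `ψ`, then `H` follows `F` step by step. The number of steps is only `n ≤ t`,
because `F` idles after its exit while `H` would run on from `ψ e`. -/
theorem exists_iterate_of_embedding {F : Frag K A E} {H : Frag K A E'} (φ : F.Label → H.Label)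
    (ψ : E → H.Label ⊕ E')
    (h : ∀ l, H.code (φ l) = (F.code l).map (Sum.elim (fun l => .inl (φ l)) ψ)) {e : E}
    {S' : K → List A} (t : ℕ) (l : F.Label) (S : K → List A)
    (ht : F.step^[t] (.inl l, S) = (.inr e, S')) :
    ∃ n ≤ t, H.step^[n] (.inl (φ l), S) = (ψ e, S') := by
  induction t generalizing l S with
  | zero => simp at ht
  | succ t ih =>
    rw [Function.iterate_succ_apply] at ht
    have key : H.step (.inl (φ l), S) =
        (Sum.elim (fun l => .inl (φ l)) ψ ((F.code l).run S).1, ((F.code l).run S).2) := by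
      change (H.code (φ l)).run S = _
      rw [h, Instr.run_map]
    change F.step^[t] ((F.code l).run S) = _ at ht
    rcases hr : (F.code l).run S with ⟨l' | e', S₁⟩
    · rw [hr] at ht key
      obtain ⟨n, hn, hs⟩ := ih l' S₁ ht
      exact ⟨n + 1, by omega, by rw [Function.iterate_succ_apply, key]; exact hs⟩
    · rw [hr] at ht key
      rw [iterate_step_inr] at ht
      cases ht
      exact ⟨1, by omega, key⟩

theorem exec_ret (e : E) (S : K → List A) : (ret e).Exec S e S 1 := rfl

theorem exec_push (k : K) (a : A) (S : K → List A) :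
    (push k a).Exec S () (Function.update S k (a :: S k)) 1 := rfl

theorem exec_pop (k : K) (S : K → List A) :
    (pop k).Exec S (S k).head? (Function.update S k (S k).tail) 1 := rfl

theorem exec_pop_nil {k : K} {S : K → List A} (h : S k = []) : (pop k).Exec S none S 1 := by
  have := exec_pop k S
  rwa [h, List.head?_nil, List.tail_nil, ← h, Function.update_eq_self] at this

theorem exec_pop_cons {k : K} {S : K → List A} {a : A} {l : List A} (h : S k = a :: l) :
    (pop k).Exec S (some a) (Function.update S k l) 1 := by
  have := exec_pop k S
  rwa [h] at this

theorem Exec.bind [Finite E] {F : Frag K A E} {G : E → Frag K A E'} {S S₁ S' : K → List A} {e : E}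
    {e' : E'} {t₁ t₂ : ℕ} (h₁ : F.Exec S e S₁ t₁) (h₂ : (G e).Exec S₁ e' S' t₂) :
    (F.bind G).Exec S e' S' (t₁ + t₂) := by
  obtain ⟨n₁, hn₁, hs₁⟩ := exists_iterate_of_embedding (H := F.bind G) Sum.inl
    (fun e => .inl (.inr ⟨e, (G e).entry⟩)) (fun _ => rfl) _ _ _ h₁
  obtain ⟨n₂, hn₂, hs₂⟩ := exists_iterate_of_embedding (H := F.bind G)
    (fun l => Sum.inr ⟨e, l⟩) Sum.inr (fun _ => rfl) _ _ _ h₂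
  refine Exec.mono (t := n₂ + n₁) ?_ (by omega)
  rw [Exec, Function.iterate_add_apply]
  exact (congrArg _ hs₁).trans hs₂

theorem Exec.iter_exit [Finite C] {F : C → Frag K A (C ⊕ E)} {c : C} {S S' : K → List A} {e : E}
    {t : ℕ} (h : (F c).Exec S (.inr e) S' t) : (iter F c).Exec S e S' t := by
  obtain ⟨n, hn, hs⟩ := exists_iterate_of_embedding (H := iter F c) (fun l => ⟨c, l⟩)
    (Sum.elim (fun c' => .inl ⟨c', (F c').entry⟩) .inr) (fun _ => rfl) _ _ _ h
  exact Exec.mono (t := n) hs hn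

theorem Exec.iter_next [Finite C] {F : C → Frag K A (C ⊕ E)} {c c' : C} {S S₁ S' : K → List A}
    {e : E} {t₁ t₂ : ℕ} (h₁ : (F c).Exec S (.inl c') S₁ t₁) (h₂ : (iter F c').Exec S₁ e S' t₂) :
    (iter F c).Exec S e S' (t₁ + t₂) := by
  obtain ⟨n, hn, hs⟩ := exists_iterate_of_embedding (H := iter F c) (fun l => ⟨c, l⟩)
    (Sum.elim (fun c' => .inl ⟨c', (F c').entry⟩) .inr) (fun _ => rfl) _ _ _ h₁
  refine Exec.mono (t := t₂ + n) ?_ (by omega)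
  rw [Exec, Function.iterate_add_apply]
  -- The two loops have the same code and differ only in the entry, on which `step` does not depend.
  have hstep : (iter F c').step = (iter F c).step := by
    funext p
    rcases p with ⟨l | e, S⟩ <;> rfl
  rw [Exec, hstep] at h₂
  exact (congrArg _ hs).trans h₂

end Semantics

/-! ### Translation to Turing machines -/

section Translation

variable [DecidableEq K]

/-- The statement of a `TM2` machine that carries out an instruction. -/
def instrStmt {L : Type} (l₀ : L) :
    Instr K A (L ⊕ Unit) → Turing.TM2.Stmt (fun _ : K => A) L (Option A)
  | .push k a (.inl l) => .push k (fun _ => a) (.goto fun _ => l)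
  | .push k a (.inr _) => .push k (fun _ => a) (.load (fun _ => none) .halt)
  | .pop k n => .pop k (fun _ o => o) (.branch (fun s => (n s).isLeft)
      (.goto fun s => (n s).elim id fun _ => l₀) (.load (fun _ => none) .halt))
  | .jump (.inl l) => .goto fun _ => l
  | .jump (.inr _) => .load (fun _ => none) .halt

/-- The Turing machine that executes a fragment. -/
noncomputable def toFinTM2 [Fintype K] [Fintype A] (F : Frag K A Unit) (k₀ k₁ : K) :
    Turing.FinTM2 where
  K := K
  k₀ := k₀
  k₁ := k₁
  Γ _ := A
  Λ := F.Label
  main := F.entry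
  ΛFin := have := F.finite_label; Fintype.ofFinite _
  σ := Option A
  initialState := none
  m l := instrStmt F.entry (F.code l)

/-- One instruction is one machine step. The internal state `v` must be arbitrary for the induction,
since pops overwrite it; at the exit it is reset to `none`, the initial state that the halting
configuration demands. -/
theorem exists_iterate_toFinTM2 [Fintype K] [Fintype A] (F : Frag K A Unit) (k₀ k₁ : K)
    {S' : K → List A} (t : ℕ) (l : F.Label) (v : Option A) (S : K → List A)
    (ht : F.step^[t] (.inl l, S) = (.inr (), S')) :
    ∃ n ≤ t, (flip Option.bind (F.toFinTM2 k₀ k₁).step)^[n]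
      (some (⟨some l, v, S⟩ : Turing.TM2.Cfg (fun _ : K => A) F.Label (Option A))) =
      some (⟨none, none, S'⟩ : Turing.TM2.Cfg (fun _ : K => A) F.Label (Option A)) := by
  induction t generalizing l v S with
  | zero => simp at ht
  | succ t ih =>
    rw [Function.iterate_succ_apply] at ht
    change F.step^[t] ((F.code l).run S) = _ at ht
    have key : ∃ v', (F.toFinTM2 k₀ k₁).step
        (⟨some l, v, S⟩ : Turing.TM2.Cfg (fun _ : K => A) F.Label (Option A)) =
        some (⟨((F.code l).run S).1.elim some fun _ => none,
          ((F.code l).run S).1.elim (fun _ => v') fun _ => none, ((F.code l).run S).2⟩ :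
          Turing.TM2.Cfg (fun _ : K => A) F.Label (Option A)) := by
      change ∃ v', some (Turing.TM2.stepAux (instrStmt F.entry (F.code l)) v S) = _
      rcases F.code l with ⟨k, a, l' | _⟩ | ⟨k, n⟩ | ⟨l' | _⟩
      · exact ⟨_, rfl⟩
      · exact ⟨none, rfl⟩
      · refine ⟨(S k).head?, ?_⟩
        simp only [instrStmt, Turing.TM2.stepAux, Instr.run]
        cases n (S k).head? <;> rfl
      · exact ⟨_, rfl⟩
      · exact ⟨none, rfl⟩
    obtain ⟨v', key⟩ := key
    rcases hr : (F.code l).run S with ⟨l' | e', S₁⟩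
    · rw [hr] at ht key
      obtain ⟨n, hn, hs⟩ := ih l' v' S₁ ht
      refine ⟨n + 1, by omega, ?_⟩
      rw [Function.iterate_succ_apply]
      exact (congrArg _ key).trans hs
    · rw [hr] at ht key
      rw [iterate_step_inr] at ht
      cases ht
      exact ⟨1, by omega, key⟩

/-- The tape machine that executes a fragment. -/
noncomputable def toTapeMachine [Fintype K] [Fintype A] (F : Frag K A Unit) (k₀ k₁ : K) :
    TapeMachine A where
  tm := F.toFinTM2 k₀ k₁
  inputAlphabet := Equiv.refl A
  outputAlphabet := Equiv.refl A
  finite_alphabet _ := inferInstanceAs (Finite A)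

/-- The halting configuration has all stacks empty except the output. Hence a program has to erase
its working memory before it exits. -/
theorem Exec.outputsWithin [Fintype K] [Fintype A] {F : Frag K A Unit} {k₀ k₁ : K} {x y : List A}
    {t : ℕ} (h : F.Exec (Function.update (fun _ => []) k₀ x) ()
      (Function.update (fun _ => []) k₁ y) t) :
    (F.toTapeMachine k₀ k₁).OutputsWithin x y t := by
  obtain ⟨n, hn, hs⟩ := exists_iterate_toFinTM2 F k₀ k₁ t _ none _ h
  refine ⟨⟨⟨n, ?_⟩, hn⟩⟩
  have hx : x.map (F.toTapeMachine k₀ k₁).inputAlphabet.symm = x := List.map_id x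
  have hy : y.map (F.toTapeMachine k₀ k₁).outputAlphabet.symm = y := List.map_id y
  have h₀ : Turing.initList (F.toFinTM2 k₀ k₁) x = (⟨some F.entry, none,
      Function.update (fun _ => []) k₀ x⟩ :
      Turing.TM2.Cfg (fun _ : K => A) F.Label (Option A)) := by
    unfold Turing.initList
    congr 1
    funext k
    obtain rfl | hk := eq_or_ne k₀ k
    · exact (dif_pos rfl).trans (Function.update_self k₀ x fun _ : K => ([] : List A)).symm
    · exact (dif_neg hk.symm).trans
        (Function.update_of_ne (β := fun _ : K => List A) hk.symm x fun _ => []).symm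
  have h₁ : Turing.haltList (F.toFinTM2 k₀ k₁) y = (⟨none, none,
      Function.update (fun _ => []) k₁ y⟩ :
      Turing.TM2.Cfg (fun _ : K => A) F.Label (Option A)) := by
    unfold Turing.haltList
    congr 1
    funext k
    obtain rfl | hk := eq_or_ne k₁ k
    · exact (dif_pos rfl).trans (Function.update_self k₁ y fun _ : K => ([] : List A)).symm
    · exact (dif_neg hk.symm).trans
        (Function.update_of_ne (β := fun _ : K => List A) hk.symm y fun _ => []).symm
  rw [hx, hy]
  change (flip Option.bind (F.toFinTM2 k₀ k₁).step)^[n]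
    (some (Turing.initList (F.toFinTM2 k₀ k₁) x)) = some (Turing.haltList (F.toFinTM2 k₀ k₁) y)
  rw [h₀, h₁]
  exact hs

end Translation

end Frag

/-! ### Binary arithmetic on lists of bits -/

/-- The number with the given bits, least significant bit first. -/
def bitsVal : List Bool → ℕ
  | [] => 0
  | b :: l => b.toNat + 2 * bitsVal l

theorem bitsVal_bits (n : ℕ) : bitsVal n.bits = n := by
  induction n using Nat.binaryRec' with
  | zero => simp [bitsVal]
  | bit b n h ih =>
    rw [Nat.bits_append_bit _ _ h, bitsVal, ih, Nat.bit_val]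
    omega

/-- Registers hold binary expansions without leading zeros. A ripple operation leaves its result
reversed, with the highest bit on top and possibly padded by zeros; dropping these and reversing
restores the canonical form. -/
theorem reverse_dropWhile_reverse (l : List Bool) :
    (l.reverse.dropWhile fun b => !b).reverse = (bitsVal l).bits := by
  induction l with
  | nil => simp [bitsVal]
  | cons b l ih =>
    have hv : bitsVal (b :: l) = Nat.bit b (bitsVal l) := by
      rw [bitsVal, Nat.bit_val]
      omega
    rw [List.reverse_cons, List.dropWhile_append, hv]
    rcases eq_or_ne (bitsVal l) 0 with h0 | h0
    · rw [h0, Nat.zero_bits, List.reverse_eq_nil_iff] at ih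
      rw [ih, h0]
      cases b <;> simp [Nat.bit]
    · rw [Nat.bits_append_bit _ _ (fun h => absurd h h0), ← ih]
      have hne : (l.reverse.dropWhile fun b => !b) ≠ [] := by
        intro h
        rw [h, List.reverse_nil] at ih
        have := congrArg bitsVal ih
        rw [bitsVal_bits] at this
        exact h0 this.symm
      rw [if_neg (by simpa using hne)]
      simp

/-- Process two lists of bits simultaneously with a carry, the shorter one extended by zeros. -/
def rippleList (f : Bool → Bool → Bool → Bool × Bool) : Bool → List Bool → List Bool →
    List Bool × Bool
  | c, [], [] => ([], c)
  | c, x :: l, [] => ((f x false c).1 :: (rippleList f (f x false c).2 l []).1,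
      (rippleList f (f x false c).2 l []).2)
  | c, [], y :: l => ((f false y c).1 :: (rippleList f (f false y c).2 [] l).1,
      (rippleList f (f false y c).2 [] l).2)
  | c, x :: l, y :: l' => ((f x y c).1 :: (rippleList f (f x y c).2 l l').1,
      (rippleList f (f x y c).2 l l').2)

theorem length_rippleList (f : Bool → Bool → Bool → Bool × Bool) (c : Bool) (l l' : List Bool) :
    (rippleList f c l l').1.length = max l.length l'.length := by
  fun_induction rippleList f c l l' <;> simp_all

/-- The sum bit and the carry of a full adder. -/
def adder (x y c : Bool) : Bool × Bool := ((x ^^ y) ^^ c, (x && y) || (c && (x || y)))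

/-- The difference bit and the borrow of a full subtractor. -/
def subtractor (x y c : Bool) : Bool × Bool := ((x ^^ y) ^^ c, (!x && y) || (c && (!x || y)))

/-- The outgoing carry has the weight of the bit just beyond the result. With this convention the
identity passes from the tails to the full lists by checking one full adder. -/
theorem bitsVal_rippleList_adder (c : Bool) (l l' : List Bool) :
    bitsVal (rippleList adder c l l').1 +
      2 ^ (rippleList adder c l l').1.length * (rippleList adder c l l').2.toNat =
    bitsVal l + bitsVal l' + c.toNat := by
  fun_induction rippleList adder c l l' with
  | case1 => simp [bitsVal]
  | case2 c x l ih =>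
    simp only [bitsVal, List.length_cons, pow_succ', mul_assoc] at ih ⊢
    cases x <;> cases c <;> simp [adder] at ih ⊢ <;> omega
  | case3 c x l ih =>
    simp only [bitsVal, List.length_cons, pow_succ', mul_assoc] at ih ⊢
    cases x <;> cases c <;> simp [adder] at ih ⊢ <;> omega
  | case4 c x l y l' ih =>
    simp only [bitsVal, List.length_cons, pow_succ', mul_assoc] at ih ⊢
    cases x <;> cases y <;> cases c <;> simp [adder] at ih ⊢ <;> omega

/-- The outgoing borrow is put on the side of the minuend, so that no truncated subtraction occurs.
As the difference is below `2 ^ length`, the final borrow decides which operand is larger. -/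
theorem bitsVal_rippleList_subtractor (c : Bool) (l l' : List Bool) :
    bitsVal l + 2 ^ (rippleList subtractor c l l').1.length *
      (rippleList subtractor c l l').2.toNat =
    bitsVal (rippleList subtractor c l l').1 + bitsVal l' + c.toNat := by
  fun_induction rippleList subtractor c l l' with
  | case1 => simp [bitsVal]
  | case2 c x l ih =>
    simp only [bitsVal, List.length_cons, pow_succ', mul_assoc] at ih ⊢
    cases x <;> cases c <;> simp [subtractor] at ih ⊢ <;> omega
  | case3 c x l ih =>
    simp only [bitsVal, List.length_cons, pow_succ', mul_assoc] at ih ⊢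
    cases x <;> cases c <;> simp [subtractor] at ih ⊢ <;> omega
  | case4 c x l y l' ih =>
    simp only [bitsVal, List.length_cons, pow_succ', mul_assoc] at ih ⊢
    cases x <;> cases y <;> cases c <;> simp [subtractor] at ih ⊢ <;> omega

theorem bitsVal_lt (l : List Bool) : bitsVal l < 2 ^ l.length := by
  induction l with
  | nil => simp [bitsVal]
  | cons b l ih =>
    rw [bitsVal, List.length_cons, pow_succ]
    have := Bool.toNat_le b
    omega

theorem bitsVal_append_true (l : List Bool) : bitsVal (l ++ [true]) = bitsVal l + 2 ^ l.length := by
  induction l with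
  | nil => simp [bitsVal]
  | cons b l ih =>
    rw [List.cons_append, bitsVal, ih, bitsVal, List.length_cons, pow_succ]
    omega

/-! ### Programs on stacks -/

namespace Frag

variable {K : Type}

/-- Pop all symbols from a stack and execute a fragment for each. -/
def drain {A : Type} [Finite A] (a : K) (g : A → Frag K A Unit) : Frag K A Unit :=
  iter (fun _ : Unit => (pop a).bind fun
    | none => ret (.inr ())
    | some x => (g x).bind fun _ => ret (.inl ())) ()

/-- Empty a stack. -/
def clear {A : Type} [Finite A] (a : K) : Frag K A Unit :=
  drain a fun _ => ret ()

/-- Move the contents of a stack onto another one, in reverse order. -/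
def move {A : Type} [Finite A] (a b : K) : Frag K A Unit :=
  drain a (push b)

/-- Move the contents of a stack onto two other ones, in reverse order. -/
def moveBoth {A : Type} [Finite A] (a b c : K) : Frag K A Unit :=
  drain a fun x => (push b x).bind fun _ => push c x

/-- Pop the zeros on top of a stack. -/
def strip (a : K) : Frag K (Option Bool) Unit :=
  iter (fun _ : Unit => (pop a).bind fun
    | none => ret (.inr ())
    | some none => ret (.inr ())
    | some (some false) => ret (.inl ())
    | some (some true) => (push a (some true)).bind fun _ => ret (.inr ())) ()

/-- The bit that is represented by the result of popping a stack, a missing bit being zero. -/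
def bitOf : Option (Option Bool) → Bool
  | some (some b) => b
  | _ => false

/-- Consume two stacks of bits and push the result of `rippleList` onto a third one. -/
def ripple (f : Bool → Bool → Bool → Bool × Bool) (a b r : K) (c : Bool) :
    Frag K (Option Bool) Bool :=
  iter (fun c => (pop a).bind fun x => (pop b).bind fun y =>
    if x = none ∧ y = none then ret (.inr c)
    else (push r (some (f (bitOf x) (bitOf y) c).1)).bind fun _ =>
      ret (.inl (f (bitOf x) (bitOf y) c).2)) c

section Semantics

variable [DecidableEq K] {S : K → List (Option Bool)}

theorem drain_nil {A : Type} [Finite A] {S : K → List A} {a : K} {g : A → Frag K A Unit}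
    (h : S a = []) : (drain a g).Exec S () S 2 := by
  refine Exec.iter_exit (t := 1 + 1) ((exec_pop_nil h).bind ?_)
  exact exec_ret _ _

theorem drain_cons {A : Type} [Finite A] {S S₁ S' : K → List A} {a : K} {g : A → Frag K A Unit}
    {x : A} {l : List A} {t t' : ℕ}
    (h : S a = x :: l) (hg : (g x).Exec (Function.update S a l) () S₁ t)
    (h₁ : (drain a g).Exec S₁ () S' t') : (drain a g).Exec S () S' (t + 2 + t') := by
  refine Exec.mono (t := 1 + (t + 1) + t') (Exec.iter_next ((exec_pop_cons h).bind ?_) h₁)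
    (by omega)
  exact hg.bind (exec_ret _ _)

theorem exec_clear {A : Type} [Finite A] {S : K → List A} {a : K} {l : List A} (h : S a = l) :
    (clear a).Exec S () (Function.update S a []) (3 * l.length + 2) := by
  induction l generalizing S with
  | nil =>
    rw [Function.update_eq_self_iff.2 h.symm]
    exact drain_nil h
  | cons x l ih =>
    have := ih (S := Function.update S a l) (by simp)
    rw [Function.update_idem] at this
    exact (drain_cons h (exec_ret _ _) this).mono (by simp; omega)

theorem exec_move {A : Type} [Finite A] {S : K → List A} {a b : K} (hab : a ≠ b) {l : List A}
    (h : S a = l) :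
    (move a b).Exec S () (Function.update (Function.update S a []) b (l.reverse ++ S b))
      (3 * l.length + 2) := by
  induction l generalizing S with
  | nil =>
    have e1 : Function.update S a [] = S := Function.update_eq_self_iff.2 h.symm
    rw [e1, List.reverse_nil, List.nil_append,
      Function.update_eq_self]
    exact drain_nil h
  | cons x l ih =>
    have := ih (S := Function.update (Function.update S a l) b (x :: S b)) (by simp [hab])
    refine Exec.mono (drain_cons h (t := 1) (S₁ := Function.update (Function.update S a l) b
      (x :: S b)) ?_ (?_ : Exec _ _ _ _ (3 * l.length + 2))) (by simp; omega)
    · refine (exec_push b x _).congr_result ?_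
      simp [hab.symm]
    · refine this.congr_result ?_
      funext k
      simp only [Function.update_apply]
      split_ifs <;> simp_all

theorem exec_moveBoth {A : Type} [Finite A] {S : K → List A} {a b c : K} (hab : a ≠ b)
    (hac : a ≠ c) (hbc : b ≠ c) {l : List A} (h : S a = l) :
    (moveBoth a b c).Exec S () (Function.update (Function.update (Function.update S a [])
      b (l.reverse ++ S b)) c (l.reverse ++ S c)) (4 * l.length + 2) := by
  induction l generalizing S with
  | nil =>
    have e1 : Function.update S a [] = S := Function.update_eq_self_iff.2 h.symm
    rw [e1, List.reverse_nil, List.nil_append,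
      Function.update_eq_self, List.nil_append, Function.update_eq_self]
    exact drain_nil h
  | cons x l ih =>
    have := ih (S := Function.update (Function.update (Function.update S a l) b (x :: S b))
      c (x :: S c)) (by simp [hab, hac])
    refine Exec.mono (drain_cons h (t := 1 + 1)
      (S₁ := Function.update (Function.update (Function.update S a l) b (x :: S b))
      c (x :: S c)) ?_ (?_ : Exec _ _ _ _ (4 * l.length + 2))) (by simp; omega)
    · refine (exec_push b x _).bind ?_
      refine (exec_push c x _).congr_result ?_
      simp [hab.symm, hac.symm, hbc.symm]
    · refine this.congr_result ?_
      funext k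
      simp only [Function.update_apply]
      split_ifs <;> simp_all

theorem exec_strip {a : K} {l : List Bool} (h : S a = l.map some) :
    (strip a).Exec S () (Function.update S a ((l.dropWhile fun b => !b).map some))
      (2 * l.length + 3) := by
  induction l generalizing S with
  | nil =>
    rw [List.dropWhile_nil, ← h, Function.update_eq_self]
    refine (Exec.iter_exit (t := 1 + 1) ((exec_pop_nil h).bind ?_)).mono (by simp)
    exact exec_ret _ _
  | cons x l ih =>
    cases x with
    | true =>
      refine (Exec.iter_exit (t := 1 + (1 + 1)) ((exec_pop_cons h).bind ?_)).mono (by simp)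
      refine (exec_push a (some true) _).bind ?_
      refine (exec_ret _ _).congr_result ?_
      simp
    | false =>
      have := ih (S := Function.update S a (l.map some)) (by simp)
      rw [Function.update_idem] at this
      refine (Exec.iter_next (t₁ := 1 + 1) ((exec_pop_cons h).bind ?_) this).mono
        (by simp; omega)
      exact exec_ret _ _

/-- Phrased with `head?` and `tail`, so that one statement covers all cases where at least one
operand is nonempty; `bitOf none = false` pads the shorter one. -/
theorem ripple_next {f : Bool → Bool → Bool → Bool × Bool} {a b r : K} {c : Bool}
    (hab : a ≠ b) (har : a ≠ r) (hbr : b ≠ r) {S₁ S' : K → List (Option Bool)} {c' : Bool}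
    {x y : Option (Option Bool)} {l l' : List (Option Bool)} {t : ℕ}
    (hx : (S a).head? = x) (hy : (S b).head? = y) (hl : (S a).tail = l) (hl' : (S b).tail = l')
    (hne : ¬(x = none ∧ y = none))
    (h : (ripple f a b r (f (bitOf x) (bitOf y) c).2).Exec
      (Function.update (Function.update (Function.update S a l) b l') r
        (some (f (bitOf x) (bitOf y) c).1 :: S r)) c' S₁ t) (hS : S₁ = S') :
    (ripple f a b r c).Exec S c' S' (4 + t) := by
  subst hx hy hl hl' hS
  refine Exec.iter_next (t₁ := 1 + (1 + (1 + 1))) ?_ h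
  refine (exec_pop a S).bind ?_
  have hb := exec_pop b (Function.update S a (S a).tail)
  rw [Function.update_of_ne hab.symm] at hb
  refine hb.bind ?_
  rw [if_neg hne]
  have hr := exec_push r (some (f (bitOf (S a).head?) (bitOf (S b).head?) c).1)
    (Function.update (Function.update S a (S a).tail) b (S b).tail)
  rw [Function.update_of_ne hbr.symm, Function.update_of_ne har.symm] at hr
  exact hr.bind (exec_ret _ _)

theorem exec_ripple (f : Bool → Bool → Bool → Bool × Bool) {a b r : K} (c : Bool)
    (hab : a ≠ b) (har : a ≠ r) (hbr : b ≠ r) {l l' : List Bool}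
    (ha : S a = l.map some) (hb : S b = l'.map some) :
    (ripple f a b r c).Exec S (rippleList f c l l').2
      (Function.update (Function.update (Function.update S a []) b []) r
        ((rippleList f c l l').1.reverse.map some ++ S r))
      (4 * max l.length l'.length + 3) := by
  fun_induction rippleList f c l l' generalizing S with
  | case1 c =>
    have e1 : Function.update S a [] = S := Function.update_eq_self_iff.2 ha.symm
    have e2 : Function.update S b [] = S := Function.update_eq_self_iff.2 hb.symm
    rw [e1, e2]
    simp only [List.reverse_nil, List.map_nil, List.nil_append, Function.update_eq_self]
    refine (Exec.iter_exit (t := 1 + (1 + 1)) ((exec_pop_nil ha).bind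
      ((exec_pop_nil hb).bind ?_))).mono (by simp)
    exact exec_ret _ _
  | case2 c x l ih | case3 c x l ih | case4 c x l y l' ih =>
    refine (ripple_next hab har hbr (congrArg List.head? ha) (congrArg List.head? hb)
      (congrArg List.tail ha) (congrArg List.tail hb) (by simp) (ih ?_ ?_) ?_).mono ?_
    · simp [hab, har]
    · simp [hbr]
    · funext k
      simp only [Function.update_apply]
      split_ifs <;> simp_all [bitOf]
    · simp
      try omega

end Semantics

end Frag

/-! ### Programs on registers -/

/-- The contents of a stack that represents a natural number. -/
def natStack (n : ℕ) : List (Option Bool) := n.bits.map some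

@[simp]
theorem natStack_zero : natStack 0 = [] := by simp [natStack]

theorem natStack_one : natStack 1 = [some true] := by simp [natStack]

theorem length_natStack (n : ℕ) : (natStack n).length = n.size := by
  simp [natStack, Nat.size_eq_bits_len]

theorem length_natStack_le {n l : ℕ} (h : n < 2 ^ l) : (natStack n).length ≤ l := by
  rw [length_natStack]
  exact Nat.size_le.2 h

theorem natStack_bit (b : Bool) (n : ℕ) (h : n = 0 → b = true) :
    natStack (Nat.bit b n) = some b :: natStack n := by
  simp [natStack, Nat.bits_append_bit _ _ h]

theorem bitOf_head?_natStack (n : ℕ) : Frag.bitOf (natStack n).head? = n.bodd := by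
  induction n using Nat.binaryRec' with
  | zero => rfl
  | bit b n h ih => simp [natStack_bit _ _ h, Frag.bitOf]

theorem tail_natStack (n : ℕ) : (natStack n).tail = natStack n.div2 := by
  simp [natStack, Nat.div2_bits_eq_tail, List.map_tail]

theorem natStack_eq_nil {n : ℕ} : natStack n = [] ↔ n = 0 := by
  rw [← List.length_eq_zero_iff, length_natStack, Nat.size_eq_zero]

theorem head?_natStack_eq_none {n : ℕ} : (natStack n).head? = none ↔ n = 0 := by
  rw [List.head?_eq_none_iff, natStack_eq_nil]

/-- The integer with given sign and absolute value. -/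
def signed (neg : Bool) (n : ℕ) : ℤ := if neg then -n else n

namespace Frag

variable {R : Type}

/-- The stacks of a machine with given contents of the registers and of three scratch stacks. -/
def withScratch (s : R → List (Option Bool)) (x y z : List (Option Bool)) :
    R ⊕ Fin 3 → List (Option Bool) :=
  Sum.elim s ![x, y, z]

/-- The stacks of a machine with given contents of the registers and empty scratch stacks. -/
def mem (s : R → List (Option Bool)) : R ⊕ Fin 3 → List (Option Bool) :=
  withScratch s [] [] []

/-- A bound for the running time of a register operation on numbers with at most `l` bits. -/
def opTime (l : ℕ) : ℕ := 100 * (l + 1)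

/-- Copy a register to a stack. -/
def copyTo (d : R ⊕ Fin 3) (b : R) : Frag (R ⊕ Fin 3) (Option Bool) Unit :=
  (clear d).bind fun _ => (move (.inl b) (.inr 0)).bind fun _ => moveBoth (.inr 0) (.inl b) d

/-- `a := a + b`. -/
def addReg (a b : R) : Frag (R ⊕ Fin 3) (Option Bool) Unit :=
  (copyTo (.inr 1) b).bind fun _ =>
  (ripple adder (.inl a) (.inr 1) (.inr 0) false).bind fun c =>
  (if c then push (.inr 0) (some true) else ret ()).bind fun _ =>
  (strip (.inr 0)).bind fun _ => move (.inr 0) (.inl a)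

/-- `a := a - b` if `b ≤ a`; the exit tells whether this is so. -/
def subReg (a b : R) : Frag (R ⊕ Fin 3) (Option Bool) Bool :=
  (copyTo (.inr 2) a).bind fun _ => (copyTo (.inr 1) b).bind fun _ =>
  (ripple subtractor (.inr 2) (.inr 1) (.inr 0) false).bind fun c =>
  if c then (clear (.inr 0)).bind fun _ => ret false
  else (strip (.inr 0)).bind fun _ => (clear (.inl a)).bind fun _ =>
    (move (.inr 0) (.inl a)).bind fun _ => ret true

/-- `a := 2 * a + b` for a bit `b`. -/
def pushBit (a : R) : Bool → Frag (R ⊕ Fin 3) (Option Bool) Unit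
  | true => push (.inl a) (some true)
  | false => (pop (.inl a)).bind fun
    | none => ret ()
    | some x => (push (.inl a) x).bind fun _ => push (.inl a) (some false)

/-- Read a number in binary, followed by an end marker. -/
def readNat (i a : R) : Frag (R ⊕ Fin 3) (Option Bool) Unit :=
  (iter (fun _ : Unit => (pop (.inl i)).bind fun
    | some (some b) => (push (.inr 0) (some b)).bind fun _ => ret (.inl ())
    | _ => ret (.inr ())) ()).bind fun _ => move (.inr 0) (.inl a)

/-- Write the integer with the absolute value in `d` and, if this is not zero, the given sign. -/
def writeInt (o d : R) (neg : Bool) : Frag (R ⊕ Fin 3) (Option Bool) Unit :=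
  (push (.inl o) none).bind fun _ => (pop (.inl d)).bind fun
    | none => push (.inl o) (some false)
    | some x => (push (.inl d) x).bind fun _ => (move (.inl d) (.inr 0)).bind fun _ =>
      (move (.inr 0) (.inl o)).bind fun _ => push (.inl o) (some neg)

section Semantics

variable {s : R → List (Option Bool)} {x y z : List (Option Bool)}

@[simp]
theorem withScratch_inl (a : R) : withScratch s x y z (.inl a) = s a := rfl

@[simp]
theorem withScratch_zero : withScratch s x y z (.inr 0) = x := rfl

@[simp]
theorem withScratch_one : withScratch s x y z (.inr 1) = y := rfl

@[simp]
theorem withScratch_two : withScratch s x y z (.inr 2) = z := rfl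

variable [DecidableEq R]

@[simp]
theorem update_withScratch_inl (a : R) (v : List (Option Bool)) :
    Function.update (withScratch s x y z) (.inl a) v =
      withScratch (Function.update s a v) x y z :=
  Sum.update_elim_inl

@[simp]
theorem update_withScratch_zero (v : List (Option Bool)) :
    Function.update (withScratch s x y z) (.inr 0) v = withScratch s v y z := by
  funext k
  rcases k with k | k
  · simp [withScratch]
  · fin_cases k <;> simp [withScratch]

@[simp]
theorem update_withScratch_one (v : List (Option Bool)) :
    Function.update (withScratch s x y z) (.inr 1) v = withScratch s x v z := by
  funext k
  rcases k with k | k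
  · simp [withScratch]
  · fin_cases k <;> simp [withScratch]

@[simp]
theorem update_withScratch_two (v : List (Option Bool)) :
    Function.update (withScratch s x y z) (.inr 2) v = withScratch s x y v := by
  funext k
  rcases k with k | k
  · simp [withScratch]
  · fin_cases k <;> simp [withScratch]

theorem exec_clear_reg (a : R) :
    (clear (.inl a)).Exec (mem s) () (mem (Function.update s a [])) (3 * (s a).length + 2) :=
  (exec_clear rfl).congr_result (by simp [mem])

/-- The word passes through scratch stack `0` and is thereby reversed twice, so both copies come out
in the original order. -/
theorem exec_copyTo {d : R ⊕ Fin 3} {b : R} (hd : d ≠ .inl b) (hd0 : d ≠ .inr 0)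
    {S : R ⊕ Fin 3 → List (Option Bool)} (h0 : S (.inr 0) = []) :
    (copyTo d b).Exec S () (Function.update S d (S (.inl b)))
      (3 * (S d).length + 7 * (S (.inl b)).length + 6) := by
  refine ((exec_clear rfl).bind ((exec_move Sum.inl_ne_inr rfl).bind
    ((exec_moveBoth Sum.inr_ne_inl hd0.symm hd.symm rfl).congr_result ?_))).mono ?_
  · funext k
    simp only [Function.update_apply]
    split_ifs <;> simp_all
  · simp only [Function.update_self, Function.update_of_ne hd0.symm, Function.update_of_ne hd.symm,
      h0]
    simp
    omega

theorem exec_copyReg {a b : R} (hab : a ≠ b) {n n' l : ℕ} (ha : s a = natStack n')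
    (hb : s b = natStack n) (hn' : n' < 2 ^ l) (hn : n < 2 ^ l) :
    (copyTo (.inl a) b).Exec (mem s) () (mem (Function.update s a (natStack n))) (opTime l) := by
  have h := exec_copyTo (S := mem s) (d := .inl a) (b := b) (by simpa) (by simp) rfl
  have h1 := length_natStack_le hn
  have h2 := length_natStack_le hn'
  simp only [mem, withScratch_inl, ha, hb, update_withScratch_inl] at h
  exact h.mono (by unfold opTime; omega)

theorem exec_pushIf (c : Bool) (l : List Bool) :
    (if c then push (.inr 0) (some true) else ret () :
      Frag (R ⊕ Fin 3) (Option Bool) Unit).Exec (withScratch s (l.reverse.map some) y z) ()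
      (withScratch s ((l ++ if c then [true] else []).reverse.map some) y z) 1 := by
  cases c
  · simpa using exec_ret _ _
  · refine (exec_push _ _ _).congr_result ?_
    simp

theorem exec_addReg {a b : R} {n n' l : ℕ} (ha : s a = natStack n) (hb : s b = natStack n')
    (hn : n < 2 ^ l) (hn' : n' < 2 ^ l) :
    (addReg a b).Exec (mem s) () (mem (Function.update s a (natStack (n + n')))) (opTime l) := by
  have h1 := length_natStack_le hn
  have h2 := length_natStack_le hn'
  have hval := bitsVal_rippleList_adder false n.bits n'.bits
  have hlen := length_rippleList adder false n.bits n'.bits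
  have hr := exec_ripple (S := withScratch s [] (natStack n') []) adder (a := .inl a)
    (b := .inr 1) (r := .inr 0) false (by simp) (by simp) (by simp) (l := n.bits) (l' := n'.bits)
    ha rfl
  rw [length_natStack, ← Nat.size_eq_bits_len] at h1 h2
  generalize rippleList adder false n.bits n'.bits = uc at hr hval hlen
  obtain ⟨u, c⟩ := uc
  simp only [withScratch_zero, update_withScratch_inl, update_withScratch_one,
    update_withScratch_zero, List.append_nil] at hr
  have hcopy := (exec_copyTo (S := mem s) (d := .inr 1) (b := b) (by simp) (by simp) rfl)
  simp only [mem, withScratch_inl, withScratch_one, update_withScratch_one, hb] at hcopy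
  have hstrip := exec_strip (S := withScratch (Function.update s a [])
    ((u ++ if c then [true] else []).reverse.map some) [] []) (a := .inr 0) rfl
  simp only [update_withScratch_zero] at hstrip
  refine (hcopy.bind (hr.bind ((exec_pushIf c u).bind (hstrip.bind
    ((exec_move Sum.inr_ne_inl rfl).congr_result ?_))))).mono ?_
  · have : bitsVal (u ++ if c then [true] else []) = n + n' := by
      simp only [bitsVal_bits] at hval
      cases c
      · simpa using hval
      · simpa [bitsVal_append_true] using hval
    simp only [update_withScratch_zero, withScratch_zero, update_withScratch_inl, withScratch_inl,
      Function.update_self, List.append_nil, Function.update_idem, mem]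
    rw [← List.map_reverse, reverse_dropWhile_reverse, this]
    rfl
  · have h3 : (List.dropWhile (fun b => !b) (u ++ if c then [true] else []).reverse).length ≤
        u.length + 1 := by
      refine (List.length_dropWhile_le _ _).trans ?_
      cases c <;> simp
    have h4 : (u ++ if c then [true] else []).length ≤ u.length + 1 := by
      cases c <;> simp
    simp only [List.length_map, List.length_reverse, length_natStack, ← Nat.size_eq_bits_len,
      List.length_nil, withScratch_zero] at hlen h1 h2 h3 h4 ⊢
    unfold opTime
    omega

/-- The subtraction is done on a copy of `a` in scratch stack `2`. If the final borrow shows that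
`b` is larger, the result is thrown away and `a` is still intact. -/
theorem exec_subReg {a b : R} {n n' l : ℕ} (ha : s a = natStack n) (hb : s b = natStack n')
    (hn : n < 2 ^ l) (hn' : n' < 2 ^ l) :
    (subReg a b).Exec (mem s) (decide (n' ≤ n))
      (mem (Function.update s a (natStack (if n' ≤ n then n - n' else n)))) (opTime l) := by
  have h1 := length_natStack_le hn
  have h2 := length_natStack_le hn'
  have hval := bitsVal_rippleList_subtractor false n.bits n'.bits
  have hlen := length_rippleList subtractor false n.bits n'.bits
  have hlt := bitsVal_lt (rippleList subtractor false n.bits n'.bits).1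
  have hr := exec_ripple (S := withScratch s [] (natStack n') (natStack n)) subtractor
    (a := .inr 2) (b := .inr 1) (r := .inr 0) false (by simp) (by simp) (by simp) (l := n.bits)
    (l' := n'.bits) rfl rfl
  rw [length_natStack, ← Nat.size_eq_bits_len] at h1 h2
  generalize rippleList subtractor false n.bits n'.bits = uc at hr hval hlen hlt
  obtain ⟨u, c⟩ := uc
  simp only [withScratch_zero, update_withScratch_one, update_withScratch_two,
    update_withScratch_zero, List.append_nil] at hr
  have hcopy := (exec_copyTo (S := mem s) (d := .inr 2) (b := a) (by simp) (by simp) rfl)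
  simp only [mem, withScratch_inl, withScratch_two, update_withScratch_two, ha] at hcopy
  have hcopy' := (exec_copyTo (S := withScratch s [] [] (natStack n)) (d := .inr 1) (b := b)
    (by simp) (by simp) rfl)
  simp only [withScratch_inl, withScratch_one, update_withScratch_one, hb] at hcopy'
  simp only [bitsVal_bits, Bool.toNat_false, add_zero] at hval hlt
  cases c with
  | true =>
    -- A borrow means `n + 2 ^ length = bitsVal u + n'` with `bitsVal u < 2 ^ length`, hence `n <
    -- n'`.
    have hle : ¬n' ≤ n := by
      simp only [Bool.toNat_true, mul_one] at hval
      omega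
    rw [if_neg hle, ← ha, Function.update_eq_self, decide_eq_false hle]
    refine Exec.mono (hcopy.bind (hcopy'.bind (hr.bind (t₂ := 3 * u.length + 2 + 1) ?_))) ?_
    · rw [if_pos rfl]
      refine ((exec_clear (a := Sum.inr 0) (l := u.reverse.map some) rfl).mono
        (by simp : _ ≤ 3 * u.length + 2)).bind ?_
      refine (exec_ret _ _).congr_result ?_
      simp [mem]
    · simp only [length_natStack, ← Nat.size_eq_bits_len, List.length_nil] at hlen h1 h2 ⊢
      unfold opTime
      omega
  | false =>
    simp only [Bool.toNat_false, mul_zero, add_zero] at hval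
    have hle : n' ≤ n := by omega
    rw [if_pos hle, decide_eq_true hle]
    have hstrip := exec_strip (S := withScratch s (u.reverse.map some) [] []) (a := .inr 0) rfl
    simp only [update_withScratch_zero] at hstrip
    have h3 : (List.dropWhile (fun b => !b) u.reverse).length ≤ u.length :=
      (List.length_dropWhile_le _ _).trans (by simp)
    refine Exec.mono (hcopy.bind (hcopy'.bind (hr.bind
      (t₂ := 2 * u.length + 3 + (3 * (natStack n).length + 2 + (3 * u.length + 2 + 1))) ?_))) ?_
    · rw [if_neg Bool.false_ne_true]
      refine (hstrip.mono (by simp)).bind ?_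
      refine (exec_clear (a := Sum.inl a) (l := natStack n) ha).bind ?_
      refine ((exec_move Sum.inr_ne_inl rfl).mono
        (by simpa using h3 : _ ≤ 3 * u.length + 2)).bind ?_
      refine (exec_ret _ _).congr_result ?_
      simp only [update_withScratch_zero, withScratch_zero, update_withScratch_inl,
        Function.update_self, List.append_nil, Function.update_idem, mem]
      rw [← List.map_reverse, reverse_dropWhile_reverse]
      congr 2
      rw [natStack]
      congr 2
      omega
    · simp only [length_natStack, ← Nat.size_eq_bits_len, List.length_nil] at hlen h1 h2 ⊢
      unfold opTime
      omega

/-- Doubling zero must push nothing, since the canonical form of `0` is the empty stack; this is why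
appending a `false` bit inspects the top first. -/
theorem exec_pushBit {a : R} {n : ℕ} (ha : s a = natStack n) (b : Bool) :
    (pushBit a b).Exec (mem s) () (mem (Function.update s a (natStack (Nat.bit b n)))) 3 := by
  cases b with
  | true =>
    refine Exec.mono ((exec_push _ _ _).congr_result ?_) (by norm_num : 1 ≤ 3)
    rw [natStack_bit _ _ (by simp)]
    simp [mem, ha]
  | false =>
    have h := exec_pop (A := Option Bool) (Sum.inl a) (mem s)
    rcases hn : natStack n with _ | ⟨x, l⟩
    · rw [natStack_eq_nil] at hn
      subst hn
      rw [natStack_zero] at ha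
      refine Exec.mono (Exec.bind (t₁ := 1) (t₂ := 1) (exec_pop_nil (k := Sum.inl a) ha) ?_)
        (by norm_num)
      refine (exec_ret _ _).congr_result ?_
      simp [Nat.bit, ← ha]
    · have h0 : n ≠ 0 := fun h => by simp [h] at hn
      refine Exec.bind (t₁ := 1) (t₂ := 1 + 1) (exec_pop_cons (k := Sum.inl a) (ha.trans hn)) ?_
      refine (exec_push _ _ _).bind ((exec_push _ _ _).congr_result ?_)
      rw [natStack_bit _ _ (fun h => absurd h h0), hn]
      simp [mem]

theorem exec_pushAll (i : R) (l : List Bool) (x r : List (Option Bool))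
    (hi : s i = l.map some ++ none :: r) :
    (iter (fun _ : Unit => (pop (Sum.inl i)).bind fun
      | some (some b) => (push (.inr 0) (some b)).bind fun _ => ret (Sum.inl ())
      | _ => ret (.inr ())) ()).Exec (withScratch s x [] []) ()
      (withScratch (Function.update s i r) ((l.map some).reverse ++ x) [] [])
      (3 * l.length + 2) := by
  induction l generalizing s x with
  | nil =>
    refine Exec.mono (Exec.iter_exit (Exec.bind (t₁ := 1) (t₂ := 1)
      (exec_pop_cons (k := Sum.inl i) hi) ?_)) (by simp)
    refine (exec_ret _ _).congr_result ?_
    simp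
  | cons b l ih =>
    have h := ih (s := Function.update s i (l.map some ++ none :: r)) (some b :: x) (by simp)
    refine Exec.mono (Exec.iter_next (Exec.bind (t₁ := 1) (t₂ := 1 + 1)
      (exec_pop_cons (k := Sum.inl i) hi) ?_) (h.congr_result ?_)) (by simp; omega)
    · refine (exec_push _ _ _).bind ?_
      refine (exec_ret _ _).congr_result ?_
      simp
    · simp

theorem exec_readNat {i a : R} (hia : i ≠ a) {n l : ℕ} (hn : n < 2 ^ l) {r : List (Option Bool)}
    (hi : s i = encodeNatBin n ++ r) (ha : s a = []) :
    (readNat i a).Exec (mem s) ()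
      (mem (Function.update (Function.update s i r) a (natStack n))) (opTime l) := by
  have hi' : s i = n.bits.map some ++ none :: r := by rw [hi, encodeNatBin]; simp
  have h1 := length_natStack_le hn
  refine Exec.mono ((exec_pushAll i _ [] r hi').bind ((exec_move Sum.inr_ne_inl rfl).congr_result
    ?_)) ?_
  · simp [mem, natStack, ha, hia.symm]
  · simp only [withScratch_zero, List.length_append, List.length_reverse, List.length_nil]
    rw [← natStack, length_natStack] at *
    rw [Nat.size_eq_bits_len]
    unfold opTime
    omega

/-- A stack is read from the top, so the word is written backwards: end marker, bits from the
highest down (obtained by two moves), sign. For `n = 0` the sign is forced to `false`, in agreement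
with `signed true 0 = 0`. -/
theorem exec_writeInt {o d : R} (hod : o ≠ d) (neg : Bool) {n l : ℕ} (hn : n < 2 ^ l)
    (hd : s d = natStack n) :
    (writeInt o d neg).Exec (mem s) ()
      (mem (Function.update (Function.update s o (encodeIntBin (signed neg n) ++ s o)) d []))
      (opTime l) := by
  have h1 := length_natStack_le hn
  have hp := exec_push (A := Option Bool) (Sum.inl o) none (mem s)
  simp only [mem, withScratch_inl, update_withScratch_inl] at hp
  rcases hx : natStack n with _ | ⟨x, r⟩
  · rw [natStack_eq_nil] at hx
    subst hx
    rw [natStack_zero] at hd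
    refine Exec.mono (hp.bind (Exec.bind (t₁ := 1) (t₂ := 1)
      (exec_pop_nil (k := Sum.inl d) ?_) ?_)) (by unfold opTime; omega)
    · simp [hod.symm, hd]
    · refine (exec_push _ _ _).congr_result ?_
      have : Function.update s d [] = s := Function.update_eq_self_iff.2 hd.symm
      rw [Function.update_comm hod, this]
      cases neg <;> simp [mem, encodeIntBin, encodeNatBin, signed]
  · refine Exec.mono (hp.bind ((exec_pop_cons (k := Sum.inl d) (a := x) (l := r) ?_).bind
      ((exec_push _ _ _).bind ((exec_move Sum.inl_ne_inr rfl).bind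
        ((exec_move Sum.inr_ne_inl rfl).bind ((exec_push _ _ _).congr_result ?_)))))) ?_
    · simp [hod.symm, hd, hx]
    · have h0 : n ≠ 0 := by
        rintro rfl
        simp at hx
      have hs : decide (signed neg n < 0) = neg := by
        cases neg <;> simp [signed]; omega
      have habs : (signed neg n).natAbs = n := by
        cases neg <;> simp [signed]
      have he : encodeIntBin (signed neg n) = some neg :: ((x :: r) ++ [none]) := by
        rw [encodeIntBin, hs, habs, encodeNatBin, ← natStack, hx]
      rw [he]
      simp [mem, Function.update_comm hod]
    · rw [hx] at h1
      simp at h1 ⊢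
      unfold opTime
      omega

end Semantics

end Frag

/-! ### The search program -/

/-- The variables of the search program. -/
inductive Var
  | one | q | m | θ | b | e | c | x | y | d | acc | r | t | nz | cnt
  deriving DecidableEq

instance : Fintype Var where
  elems := {.one, .q, .m, .θ, .b, .e, .c, .x, .y, .d, .acc, .r, .t, .nz, .cnt}
  complete v := by cases v <;> simp

/-- The registers of the search program: input, output and the variables. -/
abbrev Reg : Type := Bool ⊕ Var

/-- The values of the variables of the search program, and the contents of the input and the
output. The variable `one` has the value `1`. -/
structure Store where
  inp : List (Option Bool)
  out : List (Option Bool)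
  q : ℕ
  m : ℕ
  θ : ℕ
  b : ℕ
  e : ℕ
  c : ℕ
  x : ℕ
  y : ℕ
  d : ℕ
  acc : ℕ
  r : ℕ
  t : ℕ
  nz : ℕ
  cnt : ℕ

namespace Store

/-- The value of a variable. -/
def get (s : Store) : Var → ℕ
  | .one => 1
  | .q => s.q
  | .m => s.m
  | .θ => s.θ
  | .b => s.b
  | .e => s.e
  | .c => s.c
  | .x => s.x
  | .y => s.y
  | .d => s.d
  | .acc => s.acc
  | .r => s.r
  | .t => s.t
  | .nz => s.nz
  | .cnt => s.cnt

/-- Change the value of a variable other than `one`. -/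
def set (s : Store) : Var → ℕ → Store
  | .one, _ => s
  | .q, n => { s with q := n }
  | .m, n => { s with m := n }
  | .θ, n => { s with θ := n }
  | .b, n => { s with b := n }
  | .e, n => { s with e := n }
  | .c, n => { s with c := n }
  | .x, n => { s with x := n }
  | .y, n => { s with y := n }
  | .d, n => { s with d := n }
  | .acc, n => { s with acc := n }
  | .r, n => { s with r := n }
  | .t, n => { s with t := n }
  | .nz, n => { s with nz := n }
  | .cnt, n => { s with cnt := n }

/-- The stacks that represent the values of the variables. -/
def regs (s : Store) : Reg → List (Option Bool) :=
  Sum.elim (fun i => if i then s.out else s.inp) fun v => natStack (s.get v)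

/-- All stacks of the machine. -/
def mem (s : Store) : Reg ⊕ Fin 3 → List (Option Bool) := Frag.mem s.regs

/-- All variables have at most `l` bits. -/
def Bounded (s : Store) (l : ℕ) : Prop := ∀ v, s.get v < 2 ^ l

theorem get_set (s : Store) {a : Var} (ha : a ≠ .one) (n : ℕ) :
    (s.set a n).get = Function.update s.get a n := by
  funext v
  cases a <;> cases v <;> first | rfl | exact absurd rfl ha

theorem set_set (s : Store) (a : Var) (n n' : ℕ) : (s.set a n).set a n' = s.set a n' := by
  cases a <;> rfl

theorem set_get (s : Store) (a : Var) : s.set a (s.get a) = s := by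
  cases a <;> rfl

theorem Bounded.set {s : Store} {l : ℕ} (hs : s.Bounded l) (a : Var) {n : ℕ} (hn : n < 2 ^ l) :
    (s.set a n).Bounded l := by
  intro v
  rcases eq_or_ne a .one with rfl | ha
  · exact hs v
  · rw [get_set s ha, Function.update_apply]
    split_ifs
    exacts [hn, hs v]

theorem update_regs (s : Store) {a : Var} (ha : a ≠ .one) (n : ℕ) :
    Function.update s.regs (.inr a) (natStack n) = (s.set a n).regs := by
  rw [regs, regs, get_set s ha, Sum.update_elim_inr]
  congr 1
  · cases a <;> rfl
  · funext v
    simp only [Function.update_apply]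
    split_ifs <;> rfl

theorem update_regs_out (s : Store) (o : List (Option Bool)) :
    Function.update s.regs (.inl true) o = { s with out := o }.regs := by
  funext r
  rcases r with (_ | _) | v
  · rfl
  · simp [regs]
  · cases v <;> rfl

theorem update_regs_inp (s : Store) (o : List (Option Bool)) :
    Function.update s.regs (.inl false) o = { s with inp := o }.regs := by
  funext r
  rcases r with (_ | _) | v
  · simp [regs]
  · rfl
  · cases v <;> rfl

end Store

/-- The type of the fragments of the search program. -/
abbrev Program (E : Type) : Type 1 := Frag (Reg ⊕ Fin 3) (Option Bool) E

namespace Program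

open Frag

/-- `a := 0` -/
def zero (a : Var) : Program Unit := clear (.inl (.inr a))

/-- `a := a'` -/
def copy (a a' : Var) : Program Unit := copyTo (.inl (.inr a)) (.inr a')

/-- `a := a + a'` -/
def add (a a' : Var) : Program Unit := addReg (.inr a) (.inr a')

/-- `a := a - a'` if `a' ≤ a`; the exit tells whether this is so. -/
def sub (a a' : Var) : Program Bool := subReg (.inr a) (.inr a')

/-- Split off the last bit of a variable. -/
def shift (a : Var) : Program (Option (Option Bool)) := pop (.inl (.inr a))

/-- `a := 2 * a + b` for a bit `b` -/
def put (a : Var) (b : Bool) : Program Unit := pushBit (.inr a) b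

variable {s : Store} {l : ℕ}

theorem exec_zero (a : Var) (ha : a ≠ .one) (hs : s.get a < 2 ^ l) :
    (zero a).Exec s.mem () (s.set a 0).mem (opTime l) := by
  refine ((exec_clear_reg (s := s.regs) (Sum.inr a)).congr_result ?_).mono ?_
  · rw [← natStack_zero, s.update_regs ha]
    rfl
  · have := length_natStack_le hs
    change 3 * (natStack (s.get a)).length + 2 ≤ _
    unfold opTime
    omega

theorem exec_copy (a a' : Var) (ha : a ≠ .one) (hab : a ≠ a') (hsa : s.get a < 2 ^ l)
    (hsb : s.get a' < 2 ^ l) :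
    (copy a a').Exec s.mem () (s.set a (s.get a')).mem (opTime l) := by
  refine (exec_copyReg (s := s.regs) (a := Sum.inr a) (b := Sum.inr a') (by simpa using hab)
    rfl rfl hsa hsb).congr_result ?_
  rw [s.update_regs ha]
  rfl

theorem exec_add (a a' : Var) (ha : a ≠ .one) (hsa : s.get a < 2 ^ l) (hsb : s.get a' < 2 ^ l) :
    (add a a').Exec s.mem () (s.set a (s.get a + s.get a')).mem (opTime l) := by
  refine (exec_addReg (s := s.regs) (a := Sum.inr a) (b := Sum.inr a')
    rfl rfl hsa hsb).congr_result ?_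
  rw [s.update_regs ha]
  rfl

theorem exec_sub (a a' : Var) (ha : a ≠ .one) (hsa : s.get a < 2 ^ l) (hsb : s.get a' < 2 ^ l) :
    (sub a a').Exec s.mem (decide (s.get a' ≤ s.get a))
      (s.set a (if s.get a' ≤ s.get a then s.get a - s.get a' else s.get a)).mem (opTime l) := by
  refine (exec_subReg (s := s.regs) (a := Sum.inr a) (b := Sum.inr a')
    rfl rfl hsa hsb).congr_result ?_
  rw [s.update_regs ha]
  rfl

theorem exec_sub_of_le (a a' : Var) (ha : a ≠ .one) (hsa : s.get a < 2 ^ l)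
    (hsb : s.get a' < 2 ^ l) (h : s.get a' ≤ s.get a) :
    (sub a a').Exec s.mem true (s.set a (s.get a - s.get a')).mem (opTime l) := by
  have := exec_sub a a' ha hsa hsb
  rwa [if_pos h, decide_eq_true h] at this

theorem exec_sub_of_lt (a a' : Var) (ha : a ≠ .one) (hsa : s.get a < 2 ^ l)
    (hsb : s.get a' < 2 ^ l) (h : s.get a < s.get a') :
    (sub a a').Exec s.mem false s.mem (opTime l) := by
  have := exec_sub a a' ha hsa hsb
  rwa [if_neg (not_le.2 h), decide_eq_false (not_le.2 h), s.set_get] at this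

theorem exec_shift (a : Var) (ha : a ≠ .one) :
    (shift a).Exec s.mem (natStack (s.get a)).head? (s.set a (s.get a).div2).mem 1 := by
  have h := exec_pop (A := Option Bool) (Sum.inl (Sum.inr a)) s.mem
  have h1 : s.mem (Sum.inl (Sum.inr a)) = natStack (s.get a) := rfl
  rw [h1, tail_natStack, Store.mem, mem, update_withScratch_inl, s.update_regs ha] at h
  exact h

theorem exec_put (a : Var) (ha : a ≠ .one) (b : Bool) :
    (put a b).Exec s.mem () (s.set a (Nat.bit b (s.get a))).mem 3 := by
  refine (exec_pushBit (s := s.regs) (a := Sum.inr a) rfl b).congr_result ?_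
  rw [s.update_regs ha]
  rfl

theorem exec_write (a : Var) (ha : a ≠ .one) (neg : Bool) (hsa : s.get a < 2 ^ l) :
    (writeInt (.inl true) (.inr a) neg : Program Unit).Exec s.mem ()
      ({ s with out := encodeIntBin (signed neg (s.get a)) ++ s.out }.set a 0).mem (opTime l) := by
  refine (exec_writeInt (s := s.regs) (o := Sum.inl true) (d := Sum.inr a) (by simp) neg hsa
    rfl).congr_result ?_
  rw [s.update_regs_out, ← natStack_zero, Store.update_regs _ ha]
  rfl

theorem exec_read (a : Var) (ha : a ≠ .one) {n : ℕ} (hn : n < 2 ^ l) {r : List (Option Bool)}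
    (hi : s.inp = encodeNatBin n ++ r) (hsa : s.get a = 0) :
    (readNat (.inl false) (.inr a) : Program Unit).Exec s.mem ()
      ({ s with inp := r }.set a n).mem (opTime l) := by
  refine (exec_readNat (s := s.regs) (i := Sum.inl false) (a := Sum.inr a) (by simp) hn hi
    (by simp [Store.regs, hsa])).congr_result ?_
  rw [s.update_regs_inp, Store.update_regs _ ha]
  rfl

/-! #### The integer square root -/

/-- Subtract odd numbers from `x`, starting with `t`, as long as possible, and count them
in `b`. -/
def sqrtLoop : Program Unit :=
  iter (fun _ : Unit => (sub .x .t).bind fun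
    | true => (add .b .one).bind fun _ => (add .t .one).bind fun _ =>
      (add .t .one).bind fun _ => ret (.inl ())
    | false => ret (.inr ())) ()

/-- `b := √b` -/
def sqrtB : Program Unit :=
  (copy .x .b).bind fun _ => (zero .b).bind fun _ => (copy .t .one).bind fun _ => sqrtLoop

/-- The first `j` odd numbers sum to `j * j`. Hence after `j` rounds `x = n - j * j`, and the next
subtraction succeeds exactly if `(j + 1) * (j + 1) ≤ n`. Here `k` counts the rounds still to come.
-/
theorem exec_sqrtLoop {n k j : ℕ} (hl : 2 * n + 3 < 2 ^ l) (hk : k + j = Nat.sqrt n) :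
    sqrtLoop.Exec { s with b := j, x := n - j * j, t := 2 * j + 1 }.mem ()
      { s with b := n.sqrt, x := n - n.sqrt * n.sqrt, t := 2 * n.sqrt + 1 }.mem
      ((k + 1) * (5 * opTime l)) := by
  have hsq := Nat.sqrt_le n
  have hle : n.sqrt ≤ n := Nat.sqrt_le_self n
  have hW : 100 ≤ opTime l := by unfold opTime; omega
  have h1 : 1 < 2 ^ l := by omega
  induction k generalizing j with
  | zero =>
    obtain rfl : j = n.sqrt := by omega
    have hlt := Nat.lt_succ_sqrt n
    have hn : n - n.sqrt * n.sqrt < 2 * n.sqrt + 1 := by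
      have : (n.sqrt + 1) * (n.sqrt + 1) = n.sqrt * n.sqrt + 2 * n.sqrt + 1 := by ring
      simp only [Nat.succ_eq_add_one] at hlt
      omega
    refine Exec.mono (Exec.iter_exit (Exec.bind (t₂ := 1) (exec_sub_of_lt (l := l) .x .t (by simp)
      (by simp [Store.get]; omega) (by simp [Store.get]; omega) hn) ?_)) (by omega)
    exact exec_ret _ _
  | succ k ih =>
    have hj : j + 1 ≤ n.sqrt := by omega
    have hj2 : (j + 1) * (j + 1) ≤ n := (Nat.mul_le_mul hj hj).trans hsq
    have hj3 : (j + 1) * (j + 1) = j * j + 2 * j + 1 := by ring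
    have hn : 2 * j + 1 ≤ n - j * j := by omega
    have hfin := ih (j := j + 1) (by omega)
    have hx : n - (j + 1) * (j + 1) = n - j * j - (2 * j + 1) := by omega
    rw [hx] at hfin
    refine Exec.mono (Exec.iter_next (Exec.bind (t₂ := opTime l + (opTime l + (opTime l + 1)))
      (exec_sub_of_le (l := l) .x .t (by simp)
        (by simp [Store.get]; omega) (by simp [Store.get]; omega) hn) ?_) hfin) ?_
    · refine Exec.bind (exec_add (l := l) .b .one (by simp)
        (by simp [Store.get, Store.set]; omega) h1) ?_
      refine Exec.bind (exec_add (l := l) .t .one (by simp)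
        (by simp [Store.get, Store.set]; omega) h1) ?_
      refine Exec.bind (exec_add (l := l) .t .one (by simp)
        (by simp [Store.get, Store.set]; omega) h1) ?_
      exact exec_ret _ _
    · rw [add_mul (k + 1)]
      omega

/-- About `√n` rounds are made; the bound linear in `n` is wasteful, but `n ≤ q` in the application
and the overall budget exceeds `q`. -/
theorem exec_sqrtB {n : ℕ} (hs : s.Bounded l) (hn : s.b = n) (hl : 2 * n + 3 < 2 ^ l) :
    sqrtB.Exec s.mem () { s with b := n.sqrt, x := n - n.sqrt * n.sqrt, t := 2 * n.sqrt + 1 }.mem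
      ((n + 2) * (5 * opTime l)) := by
  subst hn
  have h1 : 1 < 2 ^ l := by omega
  have h := exec_sqrtLoop (s := s) (n := s.b) (j := 0) (l := l) (k := s.b.sqrt) hl (by omega)
  have hle : s.b.sqrt ≤ s.b := Nat.sqrt_le_self s.b
  refine Exec.mono (t := opTime l + (opTime l + (opTime l + (s.b.sqrt + 1) * (5 * opTime l)))) ?_ ?_
  · refine Exec.bind (exec_copy .x .b (by simp) (by simp) (hs _) (hs _)) ?_
    refine Exec.bind (exec_zero .b (by simp) (hs .b)) ?_
    refine Exec.bind (exec_copy .t .one (by simp) (by simp) (hs .t) h1) ?_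
    exact h
  · have := Nat.mul_le_mul_right (5 * opTime l) (Nat.succ_le_succ hle)
    have h2 : (s.b + 2) * (5 * opTime l) = s.b.succ * (5 * opTime l) + 5 * opTime l := by
      rw [Nat.succ_eq_add_one]
      ring
    rw [Nat.succ_eq_add_one] at this
    omega

end Program

/-! ### Blocks of binary digits -/

/-- Move `L` binary digits from the end of the second number to the first number. -/
def takeBits (L : ℕ) (p : ℕ × ℕ) : ℕ × ℕ :=
  (fun p : ℕ × ℕ => (Nat.bit p.2.bodd p.1, p.2.div2))^[L] p

theorem takeBits_succ (L : ℕ) (d x : ℕ) :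
    takeBits (L + 1) (d, x) = takeBits L (Nat.bit x.bodd d, x.div2) :=
  Function.iterate_succ_apply _ _ _

theorem takeBits_fst_lt (L d x : ℕ) : (takeBits L (d, x)).1 < 2 ^ L * (d + 1) := by
  induction L generalizing d x with
  | zero => simp [takeBits]
  | succ L ih =>
    rw [takeBits_succ]
    refine (ih _ _).trans_le ?_
    rw [pow_succ, mul_assoc]
    refine Nat.mul_le_mul_left _ ?_
    rw [Nat.bit_val]
    have := Bool.toNat_le x.bodd
    omega

theorem takeBits_snd_le (L d x : ℕ) : (takeBits L (d, x)).2 ≤ x := by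
  induction L generalizing d x with
  | zero => simp [takeBits]
  | succ L ih =>
    rw [takeBits_succ]
    refine (ih _ _).trans ?_
    rw [Nat.div2_val]
    omega

/-- Every block of binary digits arises. -/
theorem exists_takeBits_eq (L d v x : ℕ) (hv : v < 2 ^ L) :
    ∃ y, takeBits L (d, y) = (2 ^ L * d + v, x) ∧ y < 2 ^ L * (x + 1) := by
  induction L generalizing d v with
  | zero => exact ⟨x, by simp [takeBits]; omega, by simp⟩
  | succ L ih =>
    -- Blocks are reversed in transit: the bit moved first becomes the highest of the block. So the
    -- lowest bit of the witness is bit `L` of `v`, and the remaining bits come from `v % 2 ^ L`.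
    obtain ⟨y, hy, hlt⟩ := ih (Nat.bit (v.testBit L) d) (v % 2 ^ L) (Nat.mod_lt _ (by positivity))
    refine ⟨Nat.bit (v.testBit L) y, ?_, ?_⟩
    · rw [takeBits_succ, Nat.bodd_bit, Nat.div2_bit, hy, Nat.bit_val, Nat.testBit_eq_decide_div_mod_eq]
      congr 1
      have h1 : v / 2 ^ L < 2 := Nat.div_lt_of_lt_mul (by rwa [pow_succ] at hv)
      have h2 := Nat.div_add_mod v (2 ^ L)
      rw [Nat.mod_eq_of_lt h1]
      have h3 : v / 2 ^ L = 0 ∨ v / 2 ^ L = 1 := by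
        generalize v / 2 ^ L = w at h1
        omega
      rcases h3 with h3 | h3 <;> rw [h3] at h2 ⊢ <;> simp [pow_succ] <;> nlinarith
    · rw [Nat.bit_val, pow_succ]
      have := Bool.toNat_le (v.testBit L)
      nlinarith

/-- The digit less than `e` that is read from `L` bits of `x`. -/
def digit (L e x : ℕ) : ℕ :=
  if e ≤ (takeBits L (0, x)).1 then (takeBits L (0, x)).1 - e else (takeBits L (0, x)).1

theorem reduce_eq_mod {n q : ℕ} (h : n < 2 * q) : (if q ≤ n then n - q else n) = n % q := by
  split_ifs with hq
  · rw [Nat.mod_eq_sub_mod hq, Nat.mod_eq_of_lt (by omega)]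
  · rw [Nat.mod_eq_of_lt (by omega)]

namespace Program

open Frag

variable {s : Store} {l : ℕ}

/-! #### Iterated square roots -/

/-- Replace `b` by its square root for every zero at the end of the binary expansion of `y`,
which becomes zero if it is a power of two. -/
def rootLoop : Program Unit :=
  iter (fun _ : Unit => (shift .y).bind fun
    | some (some false) => sqrtB.bind fun _ => ret (.inl ())
    | _ => ret (.inr ())) ()

/-- `b := ⌊q ^ (1 / m)⌋` and `e := b + 1`, if `m` is a power of two. -/
def rootB : Program Unit :=
  (copy .b .q).bind fun _ => (copy .y .m).bind fun _ => rootLoop.bind fun _ =>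
  (copy .e .b).bind fun _ => add .e .one

theorem iterate_sqrt_le (k n : ℕ) : Nat.sqrt^[k] n ≤ n := by
  induction k generalizing n with
  | zero => simp
  | succ k ih => exact (ih _).trans (Nat.sqrt_le_self n)

/-- The expansion of `2 ^ k` is `k` zeros followed by a one, so `y` acts as a counter for `k` root
extractions. The bound `N` stays fixed in the induction because roots only decrease `b`; the final
`x` and `t` are leftovers of the last root. -/
theorem exec_rootLoop {k N : ℕ} (hs : s.Bounded l) (hy : s.y = 2 ^ k) (hN : s.b ≤ N)
    (hl : 2 * N + 3 < 2 ^ l) :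
    ∃ x t, rootLoop.Exec s.mem () { s with b := Nat.sqrt^[k] s.b, y := 0, x := x, t := t }.mem
      ((k + 1) * ((N + 3) * (5 * opTime l))) ∧
      { s with b := Nat.sqrt^[k] s.b, y := 0, x := x, t := t }.Bounded l := by
  have hW : 100 ≤ opTime l := by unfold opTime; omega
  induction k generalizing s with
  | zero =>
    have h := exec_shift (s := s) .y (by simp)
    have hy' : s.get .y = 1 := hy
    rw [hy', natStack_one] at h
    refine ⟨s.x, s.t, ?_, hs.set .y (by positivity)⟩
    refine Exec.mono (Exec.iter_exit (Exec.bind (t₂ := 1) h ?_)) (by nlinarith)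
    exact exec_ret _ _
  | succ k ih =>
    have h := exec_shift (s := s) .y (by simp)
    have hy' : s.get .y = Nat.bit false (2 ^ k) := by
      rw [Nat.bit_val]
      change s.y = _
      rw [hy, pow_succ]
      simp [mul_comm]
    have hk : (2 ^ k : ℕ) ≠ 0 := by positivity
    rw [hy', natStack_bit _ _ (fun h => absurd h hk), Nat.div2_bit] at h
    have hkl : 2 ^ k < 2 ^ l := by
      have := hs .y
      rw [hy', Nat.bit_val] at this
      omega
    have hs1 := hs.set .y hkl
    have hsq := exec_sqrtB hs1 rfl (by change 2 * s.b + 3 < _; omega)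
    have hle : s.b.sqrt ≤ s.b := Nat.sqrt_le_self s.b
    have hs2 := ((hs1.set .b (n := s.b.sqrt) (by omega)).set .x
      (n := s.b - s.b.sqrt * s.b.sqrt) (by omega)).set .t (n := 2 * s.b.sqrt + 1) (by omega)
    obtain ⟨x, t, hx, hb⟩ := ih hs2 rfl (hle.trans hN)
    refine ⟨x, t, ?_, hb⟩
    refine Exec.mono (Exec.iter_next (Exec.bind h (Exec.bind (t₂ := 1) hsq ?_)) hx) ?_
    · exact exec_ret _ _
    · have h1 : (s.b + 2) * (5 * opTime l) ≤ (N + 2) * (5 * opTime l) :=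
        Nat.mul_le_mul_right _ (by omega)
      have h2 : (N + 3) * (5 * opTime l) = (N + 2) * (5 * opTime l) + 5 * opTime l := by ring
      have h3 : (k + 1 + 1) * ((N + 3) * (5 * opTime l)) =
        (k + 1) * ((N + 3) * (5 * opTime l)) + (N + 3) * (5 * opTime l) := by ring
      change 1 + ((s.b + 2) * (5 * opTime l) + 1) + _ ≤ _
      omega

theorem exec_rootB {k : ℕ} (hs : s.Bounded l) (hm : s.m = 2 ^ k) (hl : 2 * s.q + 3 < 2 ^ l) :
    ∃ x t, rootB.Exec s.mem () { s with
        b := Nat.sqrt^[k] s.q, e := Nat.sqrt^[k] s.q + 1, y := 0, x := x, t := t }.mem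
      ((k + 2) * ((s.q + 3) * (5 * opTime l))) ∧
      { s with b := Nat.sqrt^[k] s.q, e := Nat.sqrt^[k] s.q + 1, y := 0, x := x, t := t }.Bounded
        l := by
  have h1 : 1 < 2 ^ l := by omega
  have hs1 : ({ s with b := s.q, y := s.m } : Store).Bounded l := (hs.set .b (hs .q)).set .y (hs .m)
  obtain ⟨x, t, hx, hb⟩ := exec_rootLoop hs1 hm le_rfl hl
  have hle := iterate_sqrt_le k s.q
  refine ⟨x, t, ?_, hb.set .e (n := Nat.sqrt^[k] s.q + 1) (by omega)⟩
  refine Exec.mono (t := opTime l + (opTime l + ((k + 1) * ((s.q + 3) * (5 * opTime l)) +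
    (opTime l + opTime l)))) ?_ ?_
  · refine Exec.bind (exec_copy .b .q (by simp) (by simp) (hs _) (hs _)) ?_
    refine Exec.bind (exec_copy .y .m (by simp) (by simp) (hs .y) (hs .m)) ?_
    refine Exec.bind hx ?_
    refine Exec.bind (exec_copy .e .b (by simp) (by simp) (hb .e) (hb .b)) ?_
    exact exec_add .e .one (by simp) (hb .b) h1
  · have h3 : (k + 2) * ((s.q + 3) * (5 * opTime l)) =
        (k + 1) * ((s.q + 3) * (5 * opTime l)) + (s.q + 3) * (5 * opTime l) := by ring
    have h4 : 3 * (5 * opTime l) ≤ (s.q + 3) * (5 * opTime l) := Nat.mul_le_mul_right _ (by omega)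
    omega

/-! #### Reading a digit -/

/-- Move a bit from `x` to `d` for each bit of `y`. -/
def readLoop : Program Unit :=
  iter (fun _ : Unit => (shift .y).bind fun
    | none => ret (.inr ())
    | some _ => (shift .x).bind fun u => (put .d (bitOf u)).bind fun _ =>
      ret (.inl ())) ()

/-- Read a digit `d` with `d < e` from `x`. -/
def readDigit : Program Unit :=
  (zero .d).bind fun _ => (copy .y .b).bind fun _ => readLoop.bind fun _ =>
  (sub .d .e).bind fun _ => ret ()

/-- Only the length of `y` matters: a copy of `b` in `y` acts as a unary counter for `b.size`, so
the block length is never computed. -/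
theorem exec_readLoop (y : ℕ) (s : Store) (hy : s.y = y) :
    readLoop.Exec s.mem () { s with
      y := 0, d := (takeBits y.size (s.d, s.x)).1, x := (takeBits y.size (s.d, s.x)).2 }.mem
      (6 * (y.size + 1)) := by
  induction y using Nat.binaryRec' generalizing s with
  | zero =>
    have h := exec_shift (s := s) .y (by simp)
    have hy' : s.get .y = 0 := hy
    rw [hy', natStack_zero] at h
    refine Exec.mono (Exec.iter_exit (Exec.bind (t₂ := 1) h ?_)) (by omega)
    exact exec_ret _ _
  | bit b n hb ih =>
    have h := exec_shift (s := s) .y (by simp)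
    have hy' : s.get .y = Nat.bit b n := hy
    rw [hy', natStack_bit _ _ hb, Nat.div2_bit] at h
    have h0 : Nat.bit b n ≠ 0 := by
      rw [Nat.bit_ne_zero_iff]
      exact hb
    rw [Nat.size_bit h0, Nat.succ_eq_add_one, takeBits_succ]
    have hx := exec_shift (s := s.set .y n) .x (by simp)
    have hp := exec_put (s := (s.set .y n).set .x s.x.div2) .d (by simp)
      (bitOf (natStack s.x).head?)
    have hfin := ih (((s.set .y n).set .x s.x.div2).set .d
      (Nat.bit (bitOf (natStack s.x).head?) s.d)) rfl
    rw [bitOf_head?_natStack] at hp hfin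
    refine Exec.mono (Exec.iter_next (Exec.bind h (Exec.bind (t₂ := 3 + 1) hx ?_)) hfin) (by omega)
    change ((put .d (bitOf (natStack s.x).head?)).bind fun _ => _).Exec _ _ _ _
    rw [bitOf_head?_natStack]
    exact Exec.bind hp (exec_ret _ _)

theorem exec_readDigit (hs : s.Bounded l) :
    readDigit.Exec s.mem () { s with
      y := 0, d := digit s.b.size s.e s.x, x := (takeBits s.b.size (0, s.x)).2 }.mem
      ((l + 6) * opTime l) := by
  have hsize : s.b.size ≤ l := Nat.size_le.2 (hs .b)
  have hd : 2 ^ s.b.size ≤ 2 ^ l := Nat.pow_le_pow_right (by norm_num) hsize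
  have hlt := takeBits_fst_lt s.b.size 0 s.x
  refine Exec.mono (t := opTime l + (opTime l + (6 * (s.b.size + 1) + (opTime l + 1)))) ?_ ?_
  · refine Exec.bind (exec_zero .d (by simp) (hs _)) ?_
    refine Exec.bind (exec_copy .y .b (by simp) (by simp) (hs .y) (hs .b)) ?_
    refine Exec.bind (exec_readLoop s.b _ rfl) ?_
    refine Exec.bind (exec_sub .d .e (by simp) ?_ (hs .e)) ?_
    · change (takeBits s.b.size (0, s.x)).1 < _
      omega
    · exact exec_ret _ _
  · have : 100 ≤ opTime l := by unfold opTime; omega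
    nlinarith

/-! #### Arithmetic modulo `q` -/

/-- `a := a + a'` modulo `q` -/
def addMod (a a' : Var) : Program Unit :=
  (add a a').bind fun _ => (sub a .q).bind fun _ => ret ()

theorem exec_addMod (a a' : Var) (ha : a ≠ .one) (haq : a ≠ .q) (hs : s.Bounded l)
    (hl : 2 * s.q ≤ 2 ^ l) (h : s.get a + s.get a' < 2 * s.q) :
    (addMod a a').Exec s.mem () (s.set a ((s.get a + s.get a') % s.q)).mem (3 * opTime l) := by
  have h1 : (s.set a (s.get a + s.get a')).get a = s.get a + s.get a' := by
    simp [Store.get_set s ha]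
  have h2 : (s.set a (s.get a + s.get a')).get .q = s.q := by
    rw [Store.get_set s ha, Function.update_of_ne haq.symm]
    rfl
  have h3 := exec_sub (l := l) (s := s.set a (s.get a + s.get a')) a .q ha (by omega) (by omega)
  rw [h1, h2, reduce_eq_mod h, Store.set_set] at h3
  refine Exec.mono (Exec.bind (exec_add (l := l) a a' ha (hs _) (hs _))
    (Exec.bind (t₂ := 1) h3 ?_)) ?_
  · exact exec_ret _ _
  · unfold opTime
    omega

/-- Add the product of `acc` and `t` to `r` modulo `q`. -/
def mulLoop : Program Unit :=
  iter (fun _ : Unit => (shift .acc).bind fun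
    | none => ret (.inr ())
    | some u => (if bitOf (some u) then addMod .r .t else ret ()).bind fun _ =>
      (addMod .t .t).bind fun _ => ret (.inl ())) ()

/-- `r := acc * θ` modulo `q` -/
def mulMod : Program Unit :=
  (copy .t .θ).bind fun _ => (zero .r).bind fun _ => mulLoop

/-- Double and add: the quantity `R + a * T` is invariant when the last bit of `a` is split off, `T`
is added to `R` if that bit is set, and `T` is doubled. The final value of `t` is irrelevant. -/
theorem exec_mulLoop {q : ℕ} [NeZero q] (hl : 2 * q ≤ 2 ^ l) (a : ℕ) (s : Store)
    (hs : s.Bounded l) (hq : s.q = q) (R T : ZMod q) (ha : s.acc = a) (hR : s.r = R.val)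
    (hT : s.t = T.val) :
    ∃ T' : ZMod q, mulLoop.Exec s.mem ()
      { s with acc := 0, r := (R + a * T).val, t := T'.val }.mem (7 * opTime l * (a.size + 1)) := by
  have hW : 100 ≤ opTime l := by unfold opTime; omega
  induction a using Nat.binaryRec' generalizing s R T with
  | zero =>
    have h := exec_shift (s := s) .acc (by simp)
    have hy' : s.get .acc = 0 := ha
    rw [hy', natStack_zero] at h
    refine ⟨T, Exec.mono (Exec.iter_exit (Exec.bind (t₂ := 1) h ?_)) (by simp; omega)⟩
    rw [Nat.cast_zero, zero_mul, add_zero, ← hR, ← hT]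
    exact exec_ret _ _
  | bit b n hb ih =>
    have h := exec_shift (s := s) .acc (by simp)
    have hy' : s.get .acc = Nat.bit b n := ha
    rw [hy', natStack_bit _ _ hb, Nat.div2_bit] at h
    have h0 : Nat.bit b n ≠ 0 := by
      rw [Nat.bit_ne_zero_iff]
      exact hb
    have hvR := R.val_lt
    have hvT := T.val_lt
    have hn : n < 2 ^ l := by
      have := hs .acc
      rw [hy', Nat.bit_val] at this
      omega
    have hs1 := hs.set .acc hn
    have key : (if bitOf (some (some b)) then addMod .r .t else ret () : Program Unit).Exec
        (s.set .acc n).mem () ((s.set .acc n).set .r (R + b.toNat * T).val).mem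
        (3 * opTime l) := by
      cases b with
      | false =>
        have : ((s.set .acc n).set .r (R + (false.toNat : ℕ) * T).val) = s.set .acc n := by
          simp [← hR, Store.set]
        rw [this]
        exact Exec.mono (exec_ret _ _) (by omega)
      | true =>
        have := exec_addMod (s := s.set .acc n) .r .t (by simp) (by simp) hs1
          (by rw [← hq] at hl; exact hl) (by change s.r + s.t < 2 * s.q; omega)
        have e : (R + (true.toNat : ℕ) * T).val = (s.r + s.t) % s.q := by
          rw [hR, hT, hq, ← ZMod.val_add]
          simp
        rw [e]
        exact this
    have hvR' := (R + b.toNat * T).val_lt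
    have hs2 := hs1.set .r (n := (R + b.toNat * T).val) (by omega)
    have h3 := exec_addMod (s := (s.set .acc n).set .r (R + b.toNat * T).val) .t .t (by simp)
      (by simp) hs2 (by rw [← hq] at hl; exact hl) (by change s.t + s.t < 2 * s.q; omega)
    have hvT' := (T + T).val_lt
    have e : (s.t + s.t) % s.q = (T + T).val := by
      rw [hT, hq, ← ZMod.val_add]
    change Exec _ _ _ (Store.mem (Store.set _ _ ((s.t + s.t) % s.q))) _ at h3
    rw [e] at h3
    obtain ⟨T', hT'⟩ := ih _ (hs2.set .t (n := (T + T).val) (by omega)) hq (R + b.toNat * T) (T + T)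
      rfl rfl rfl
    refine ⟨T', ?_⟩
    have e2 : R + b.toNat * T + n * (T + T) = R + (Nat.bit b n : ℕ) * T := by
      rw [Nat.bit_val]
      push_cast
      ring
    rw [e2] at hT'
    refine Exec.mono (Exec.iter_next (Exec.bind h (t₂ := 3 * opTime l + (3 * opTime l + 1)) ?_)
      hT') ?_
    · exact Exec.bind key (Exec.bind h3 (exec_ret _ _))
    · rw [Nat.size_bit h0, Nat.succ_eq_add_one, mul_add (7 * opTime l) (n.size + 1)]
      omega

end Program

/-! ### Candidates: digit lists coded by numbers, and Horner's rule -/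

theorem natAbs_signed (neg : Bool) (n : ℕ) : (signed neg n).natAbs = n := by
  cases neg <;> simp [signed]

/-- The first digit, with its sign, in the number `x`. -/
def nextDigit (L e x : ℕ) : ℤ := signed x.bodd (digit L e x.div2)

/-- What remains of the number `x` after the first digit. -/
def restDigits (L x : ℕ) : ℕ := (takeBits L (0, x.div2)).2

/-- The list of the first `n` digits with absolute value less than `e`, each with a sign and `L`
bits, in the number `x`. -/
def decode (L e : ℕ) : ℕ → ℕ → List ℤ
  | 0, _ => []
  | n + 1, x => nextDigit L e x :: decode L e n (restDigits L x)

/-- Evaluation of a polynomial, given by its coefficients with the highest one first, by Horner's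
rule, starting with `A`. -/
def horner {R : Type*} [CommRing R] (x : R) (A : R) (zs : List ℤ) : R :=
  zs.foldl (fun (A : R) (z : ℤ) => A * x + (z : R)) A

/-- Prepend the encodings of the integers in a list, so that the last one comes first. -/
def writeAll (zs : List ℤ) (o : List (Option Bool)) : List (Option Bool) :=
  zs.foldl (fun o z => encodeIntBin z ++ o) o

/-- The sum of absolute values. -/
def absSum (zs : List ℤ) : ℕ := (zs.map Int.natAbs).sum

theorem length_encodeIntBin_le {z : ℤ} {l : ℕ} (h : z.natAbs < 2 ^ l) :
    (encodeIntBin z).length ≤ l + 2 := by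
  have := Nat.size_le.2 h
  simp [encodeIntBin, encodeNatBin, Nat.size_eq_bits_len]
  omega

theorem length_writeAll_le {l : ℕ} (zs : List ℤ) (h : ∀ z ∈ zs, z.natAbs < 2 ^ l)
    (o : List (Option Bool)) : (writeAll zs o).length ≤ zs.length * (l + 2) + o.length := by
  induction zs generalizing o with
  | nil => simp [writeAll]
  | cons z zs ih =>
    have h1 := ih (fun z hz => h z (List.mem_cons_of_mem _ hz)) (encodeIntBin z ++ o)
    have h2 := length_encodeIntBin_le (h z List.mem_cons_self)
    change (writeAll zs (encodeIntBin z ++ o)).length ≤ _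
    rw [List.length_append] at h1
    rw [List.length_cons, add_mul]
    omega

theorem length_decode (L e n x : ℕ) : (decode L e n x).length = n := by
  induction n generalizing x with
  | zero => rfl
  | succ n ih => simp [decode, ih]

theorem natAbs_lt_of_mem_decode {L e N : ℕ} (hN : ∀ x, digit L e x ≤ N) {n x : ℕ} {z : ℤ}
    (hz : z ∈ decode L e n x) : z.natAbs ≤ N := by
  induction n generalizing x with
  | zero => simp [decode] at hz
  | succ n ih =>
    rw [decode, List.mem_cons] at hz
    rcases hz with rfl | hz
    · rw [nextDigit, natAbs_signed]
      exact hN _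
    · exact ih hz

/-! ### Programs that evaluate one candidate -/

namespace Program

open Frag

variable {s : Store} {l : ℕ}

theorem exec_mulMod {q : ℕ} [NeZero q] (hl : 2 * q ≤ 2 ^ l) (hs : s.Bounded l) (hq : s.q = q)
    (Θ A : ZMod q) (hθ : s.θ = Θ.val) (hA : s.acc = A.val) :
    ∃ T : ZMod q, mulMod.Exec s.mem () { s with acc := 0, r := (A * Θ).val, t := T.val }.mem
      ((7 * l + 9) * opTime l) := by
  have hv := Θ.val_lt
  obtain ⟨T, hT⟩ := exec_mulLoop hl A.val { s with r := 0, t := s.θ }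
    ((hs.set .t (hs .θ)).set .r (by positivity)) hq 0 Θ hA ZMod.val_zero.symm hθ
  rw [zero_add, ZMod.natCast_zmod_val] at hT
  refine ⟨T, Exec.mono (t := opTime l + (opTime l + 7 * opTime l * (A.val.size + 1))) ?_ ?_⟩
  · refine Exec.bind (exec_copy .t .θ (by simp) (by simp) (hs _) (hs _)) ?_
    refine Exec.bind (exec_zero .r (by simp) (hs .r)) ?_
    exact hT
  · have : A.val.size ≤ l := by
      rw [← hA]
      exact Nat.size_le.2 (hs .acc)
    nlinarith [Nat.mul_le_mul_left (7 * opTime l) this]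

/-- Add the digit `d`, with the given sign, to `r` modulo `q`. -/
def addDigit : Bool → Program Unit
  | true => (add .r .q).bind fun _ => (sub .r .d).bind fun _ => (sub .r .q).bind fun _ => ret ()
  | false => addMod .r .d

/-- For a negative digit `q` is added first, so that subtracting `d ≤ q` does not fail. In both
cases the value stays below `2 * q`, and one conditional subtraction of `q` reduces it. -/
theorem exec_addDigit {q : ℕ} [NeZero q] (hl : 2 * q ≤ 2 ^ l) (hs : s.Bounded l) (hq : s.q = q)
    (R : ZMod q) (hR : s.r = R.val) (hd : s.d ≤ q) (neg : Bool) :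
    (addDigit neg).Exec s.mem () { s with r := (R + (signed neg s.d : ℤ)).val }.mem
      (4 * opTime l) := by
  have hv := R.val_lt
  have hW : 100 ≤ opTime l := by unfold opTime; omega
  cases neg with
  | false =>
    have h := exec_addMod (l := l) (s := s) .r .d (by simp) (by simp) hs (by omega)
      (by change s.r + s.d < 2 * s.q; omega)
    have e : (R + (signed false s.d : ℤ)).val = (s.r + s.d) % s.q := by
      rw [hR, hq, ← ZMod.val_natCast]
      simp [signed]
    rw [e]
    exact h.mono (by omega)
  | true =>
    have e : (R + (signed true s.d : ℤ)).val = (s.r + s.q - s.d) % s.q := by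
      rw [hR, hq, ← ZMod.val_natCast, Nat.cast_sub (by omega)]
      simp [signed, sub_eq_add_neg]
    have h1 := exec_add (s := s) .r .q (by simp) (hs _) (hs _)
    have h2 := exec_sub_of_le (l := l) (s := s.set .r (s.r + s.q)) .r .d (by simp)
      (by change s.r + s.q < _; omega) (hs .d) (by change s.d ≤ s.r + s.q; omega)
    have h3 := exec_sub (l := l) (s := s.set .r (s.r + s.q - s.d)) .r .q (by simp)
      (by change s.r + s.q - s.d < _; omega) (hs .q)
    have e2 : (if (s.set .r (s.r + s.q - s.d)).get .q ≤ (s.set .r (s.r + s.q - s.d)).get .r then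
        (s.set .r (s.r + s.q - s.d)).get .r - (s.set .r (s.r + s.q - s.d)).get .q
        else (s.set .r (s.r + s.q - s.d)).get .r) = (s.r + s.q - s.d) % s.q :=
      reduce_eq_mod (n := s.r + s.q - s.d) (q := s.q) (by omega)
    rw [e2] at h3
    rw [e]
    exact Exec.mono (Exec.bind h1 (Exec.bind h2 (Exec.bind h3 (exec_ret _ _)))) (by omega)

/-- Read a digit from `x`, carry out a step of Horner's rule in `acc`, add the absolute value of
the digit to `nz`, and write the digit. -/
def step : Program Unit :=
  (shift .x).bind fun u => readDigit.bind fun _ => mulMod.bind fun _ =>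
  (addDigit (bitOf u)).bind fun _ => (copy .acc .r).bind fun _ => (add .nz .d).bind fun _ =>
  writeInt (.inl true) (.inr .d) (bitOf u)

theorem exec_step {q : ℕ} [NeZero q] (hl : 2 * q ≤ 2 ^ l) (hs : s.Bounded l) (hq : s.q = q)
    (Θ A : ZMod q) (hθ : s.θ = Θ.val) (hA : s.acc = A.val)
    (hd : digit s.b.size s.e s.x.div2 ≤ q) (hnz : s.nz + q < 2 ^ l) :
    ∃ t, step.Exec s.mem () { s with
        x := restDigits s.b.size s.x
        y := 0
        d := 0
        r := (A * Θ + (nextDigit s.b.size s.e s.x : ℤ)).val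
        acc := (A * Θ + (nextDigit s.b.size s.e s.x : ℤ)).val
        t := t
        nz := s.nz + (nextDigit s.b.size s.e s.x).natAbs
        out := encodeIntBin (nextDigit s.b.size s.e s.x) ++ s.out }.mem
        ((8 * l + 23) * opTime l) ∧ t < 2 ^ l := by
  have hW : 100 ≤ opTime l := by unfold opTime; omega
  have hdiv : s.x.div2 < 2 ^ l := by
    have : s.x < 2 ^ l := hs .x
    rw [Nat.div2_val]
    omega
  have hx : (shift .x).Exec s.mem (natStack s.x).head? { s with x := s.x.div2 }.mem 1 :=
    exec_shift .x (by simp)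
  have hr : readDigit.Exec { s with x := s.x.div2 }.mem () { s with
      y := 0, d := digit s.b.size s.e s.x.div2, x := restDigits s.b.size s.x }.mem
      ((l + 6) * opTime l) := exec_readDigit (hs.set .x hdiv)
  have hrest : restDigits s.b.size s.x < 2 ^ l := (takeBits_snd_le _ _ _).trans_lt hdiv
  have hdig : nextDigit s.b.size s.e s.x = signed s.x.bodd (digit s.b.size s.e s.x.div2) := rfl
  have habs : (nextDigit s.b.size s.e s.x).natAbs = digit s.b.size s.e s.x.div2 :=
    natAbs_signed _ _
  rw [habs]
  generalize nextDigit s.b.size s.e s.x = z at hdig ⊢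
  generalize restDigits s.b.size s.x = X at hr hrest ⊢
  generalize digit s.b.size s.e s.x.div2 = D at hr hd hdig ⊢
  have hs2 : Store.Bounded { s with y := 0, d := D, x := X } l :=
    ((hs.set .y (n := 0) (by positivity)).set .d (n := D) (by omega)).set .x hrest
  obtain ⟨T, hT⟩ := exec_mulMod hl hs2 hq Θ A hθ hA
  have hv := (A * Θ).val_lt
  have hvT := T.val_lt
  have hs3 : Store.Bounded { s with
      y := 0, d := D, x := X, acc := 0, r := (A * Θ).val, t := T.val } l :=
    ((hs2.set .acc (n := 0) (by positivity)).set .r (n := (A * Θ).val) (by omega)).set .t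
      (n := T.val) (by omega)
  have ha := exec_addDigit hl hs3 hq (A * Θ) rfl hd s.x.bodd
  simp only [← hdig] at ha
  have hv' := (A * Θ + (z : ZMod q)).val_lt
  generalize (A * Θ + (z : ZMod q)).val = A' at ha hv' ⊢
  generalize (A * Θ).val = R at hs3 ha hT
  have hs4 : Store.Bounded { s with y := 0, d := D, x := X, acc := 0, r := A', t := T.val } l :=
    hs3.set .r (n := A') (by omega)
  have hs5 : Store.Bounded { s with y := 0, d := D, x := X, acc := A', r := A', t := T.val } l :=
    hs4.set .acc (n := A') (by omega)
  have hs6 : Store.Bounded { s with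
      y := 0, d := D, x := X, acc := A', r := A', t := T.val, nz := s.nz + D } l :=
    hs5.set .nz (n := s.nz + D) (by omega)
  have hw := exec_write .d (by simp) s.x.bodd (hs6 .d)
  have h5 := exec_copy .acc .r (by simp) (by simp) (hs4 .acc) (hs4 .r)
  have h6 := exec_add .nz .d (by simp) (hs5 .nz) (hs5 .d)
  simp only [Store.set, Store.get, ← hdig] at hw h5 h6
  -- The register stages add up to `(l + 6) + (7 * l + 9) + 4 + 3 = 8 * l + 22` units of `opTime l`;
  -- one more unit pays for the initial shift.
  refine ⟨T.val, Exec.mono (t := 1 + ((l + 6) * opTime l + ((7 * l + 9) * opTime l +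
    (4 * opTime l + (opTime l + (opTime l + opTime l)))))) ?_ (by linarith), by omega⟩
  refine Exec.bind hx (Exec.bind hr (Exec.bind hT ?_))
  rw [bitOf_head?_natStack]
  exact Exec.bind ha (Exec.bind h5 (Exec.bind h6 hw))

/-- Process `cnt` digits of `x`. -/
def evalLoop : Program Unit :=
  iter (fun _ : Unit => (sub .cnt .one).bind fun
    | true => step.bind fun _ => ret (.inl ())
    | false => ret (.inr ())) ()

/-- Summing the absolute values in `nz` is the nonzero test: the sum vanishes only for the zero
list. Each digit adds at most `q`, whence the overflow condition `hnz`. Horner's rule takes the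
highest coefficient first and output is prepended, so the constant coefficient ends in front. -/
theorem exec_evalLoop {q : ℕ} [NeZero q] (hl : 2 * q ≤ 2 ^ l) (Θ : ZMod q) (n : ℕ) (s : Store)
    (hs : s.Bounded l) (hq : s.q = q) (A : ZMod q) (hθ : s.θ = Θ.val) (hA : s.acc = A.val)
    (hd : ∀ x, digit s.b.size s.e x ≤ q) (hnz : s.nz + n * q < 2 ^ l) (hn : s.cnt = n) :
    ∃ x y d r t, evalLoop.Exec s.mem () { s with
        x := x
        y := y
        d := d
        r := r
        t := t
        cnt := 0
        acc := (horner Θ A (decode s.b.size s.e n s.x)).val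
        nz := s.nz + absSum (decode s.b.size s.e n s.x)
        out := writeAll (decode s.b.size s.e n s.x) s.out }.mem
        ((n + 1) * ((8 * l + 25) * opTime l)) ∧
      { s with
        x := x
        y := y
        d := d
        r := r
        t := t
        cnt := 0
        acc := (horner Θ A (decode s.b.size s.e n s.x)).val
        nz := s.nz + absSum (decode s.b.size s.e n s.x)
        out := writeAll (decode s.b.size s.e n s.x) s.out }.Bounded l := by
  have hW : 100 ≤ opTime l := by unfold opTime; omega
  have hq0 : 0 < q := Nat.pos_of_neZero q
  have h1 : 1 < 2 ^ l := by omega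
  induction n generalizing s A with
  | zero =>
    have hres : ({ s with
        x := s.x
        y := s.y
        d := s.d
        r := s.r
        t := s.t
        cnt := 0
        acc := (horner Θ A (decode s.b.size s.e 0 s.x)).val
        nz := s.nz + absSum (decode s.b.size s.e 0 s.x)
        out := writeAll (decode s.b.size s.e 0 s.x) s.out } : Store) = s := by
      simp only [horner, decode, List.foldl_nil, ← hA, absSum, List.map_nil, List.sum_nil,
        add_zero, writeAll]
      rw [← hn]
    refine ⟨s.x, s.y, s.d, s.r, s.t, ?_⟩
    rw [hres]
    refine ⟨Exec.mono (Exec.iter_exit (Exec.bind (t₂ := 1) (exec_sub_of_lt (l := l) .cnt .one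
      (by simp) (hs _) h1 (by change s.cnt < 1; omega)) ?_)) (by nlinarith), hs⟩
    exact exec_ret _ _
  | succ n ih =>
    have hcnt : s.cnt < 2 ^ l := hs .cnt
    have hs1 := hs.set .cnt (n := s.cnt - 1) (by omega)
    rw [add_mul, one_mul] at hnz
    obtain ⟨t, ht, htl⟩ := exec_step hl hs1 hq Θ A hθ hA (hd _) (by change s.nz + q < _; omega)
    have hdiv : s.x.div2 < 2 ^ l := by
      have : s.x < 2 ^ l := hs .x
      rw [Nat.div2_val]
      omega
    have habs : (nextDigit s.b.size s.e s.x).natAbs ≤ q := by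
      rw [nextDigit, natAbs_signed]
      exact hd _
    have hrest : restDigits s.b.size s.x < 2 ^ l := (takeBits_snd_le _ _ _).trans_lt hdiv
    simp only [Store.set] at ht
    simp only [decode, horner, List.foldl_cons, absSum, List.map_cons, List.sum_cons, writeAll,
      ← add_assoc]
    generalize nextDigit s.b.size s.e s.x = z at ht habs ⊢
    generalize restDigits s.b.size s.x = X at ht hrest ⊢
    have hv := (A * Θ + (z : ZMod q)).val_lt
    have hs2 : Store.Bounded { s with
        x := X
        y := 0
        d := 0
        r := (A * Θ + (z : ZMod q)).val
        acc := (A * Θ + (z : ZMod q)).val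
        t := t
        nz := s.nz + z.natAbs
        cnt := s.cnt - 1
        out := encodeIntBin z ++ s.out } l := by
      have h0 : 0 < 2 ^ l := by positivity
      have hA' : (A * Θ + (z : ZMod q)).val < 2 ^ l := by omega
      have hz' : s.nz + z.natAbs < 2 ^ l := by omega
      intro v
      cases v
      exacts [h1, hs .q, hs .m, hs .θ, hs .b, hs .e, hs .c, hrest, h0, h0, hA', hA', htl, hz',
        hs1 .cnt]
    have hnz' : s.nz + z.natAbs + n * q < 2 ^ l := by omega
    have hcnt' : s.cnt - 1 = n := by omega
    obtain ⟨x, y, d, r, t', hex, hb⟩ := ih _ hs2 hq (A * Θ + (z : ZMod q)) hθ rfl hd hnz' hcnt'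
    have hsub := exec_sub_of_le (l := l) .cnt .one (by simp) (hs _) h1 (by change 1 ≤ s.cnt; omega)
    simp only [Store.set, Store.get] at hsub
    have htime : opTime l + ((8 * l + 23) * opTime l + 1) +
        (n + 1) * ((8 * l + 25) * opTime l) ≤ (n + 1 + 1) * ((8 * l + 25) * opTime l) := by
      linarith
    refine ⟨x, y, d, r, t', Exec.mono (Exec.iter_next (Exec.bind hsub ?_) hex) htime, hb⟩
    exact Exec.bind ht (exec_ret _ _)

end Program

/-! ### The search over all candidates -/

/-- The number `c` encodes a nonzero list of digits on which Horner's rule yields zero. -/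
def IsSolution {q : ℕ} (Θ : ZMod q) (L e m c : ℕ) : Prop :=
  horner Θ 0 (decode L e m c) = 0 ∧ absSum (decode L e m c) ≠ 0

namespace Program

open Frag

variable {s : Store} {l : ℕ}

/-- Increase `c`, decode it and carry out Horner's rule. -/
def attempt : Program Unit :=
  (add .c .one).bind fun _ => (copy .x .c).bind fun _ => (zero .acc).bind fun _ =>
  (zero .nz).bind fun _ => Frag.bind (clear (.inl (.inl true))) fun _ =>
  (copy .cnt .m).bind fun _ => evalLoop

/-- Every attempt writes its digits, so the output of the failed predecessor has to be erased; `ho`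
bounds what that costs. -/
theorem exec_attempt {q : ℕ} [NeZero q] (hl : 2 * q ≤ 2 ^ l) (Θ : ZMod q)
    (hs : s.Bounded l) (hq : s.q = q) (hθ : s.θ = Θ.val) (hd : ∀ x, digit s.b.size s.e x ≤ q)
    (hnz : s.m * q < 2 ^ l) (hc : s.c + 1 < 2 ^ l) (ho : s.out.length ≤ s.m * (l + 2)) :
    ∃ x y d r t, attempt.Exec s.mem () { s with
        c := s.c + 1
        x := x
        y := y
        d := d
        r := r
        t := t
        cnt := 0
        acc := (horner Θ 0 (decode s.b.size s.e s.m (s.c + 1))).val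
        nz := absSum (decode s.b.size s.e s.m (s.c + 1))
        out := writeAll (decode s.b.size s.e s.m (s.c + 1)) [] }.mem
        ((s.m + 1) * ((8 * l + 31) * opTime l)) ∧
      { s with
        c := s.c + 1
        x := x
        y := y
        d := d
        r := r
        t := t
        cnt := 0
        acc := (horner Θ 0 (decode s.b.size s.e s.m (s.c + 1))).val
        nz := absSum (decode s.b.size s.e s.m (s.c + 1))
        out := writeAll (decode s.b.size s.e s.m (s.c + 1)) [] }.Bounded l := by
  have hq0 : 0 < q := Nat.pos_of_neZero q
  have h1 : 1 < 2 ^ l := by omega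
  have h0 : 0 < 2 ^ l := by omega
  have hs1 : Store.Bounded { s with
      c := s.c + 1, x := s.c + 1, acc := 0, nz := 0, out := [], cnt := s.m } l := by
    intro v
    cases v
    exacts [h1, hs .q, hs .m, hs .θ, hs .b, hs .e, hc, hc, hs .y, hs .d, h0, hs .r, hs .t, h0,
      hs .m]
  obtain ⟨x, y, d, r, t, hex, hb⟩ := exec_evalLoop hl Θ s.m _ hs1 hq 0 hθ ZMod.val_zero.symm hd
    (by simpa using hnz) rfl
  simp only [zero_add] at hex hb
  have e1 : (add .c .one).Exec s.mem () { s with c := s.c + 1 }.mem (opTime l) :=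
    exec_add .c .one (by simp) (hs _) h1
  have e2 : (copy .x .c).Exec { s with c := s.c + 1 }.mem ()
      { s with c := s.c + 1, x := s.c + 1 }.mem (opTime l) :=
    exec_copy .x .c (by simp) (by simp) (hs .x) hc
  have e3 : (zero .acc).Exec { s with c := s.c + 1, x := s.c + 1 }.mem ()
      { s with c := s.c + 1, x := s.c + 1, acc := 0 }.mem (opTime l) :=
    exec_zero .acc (by simp) (hs .acc)
  have e4 : (zero .nz).Exec { s with c := s.c + 1, x := s.c + 1, acc := 0 }.mem ()
      { s with c := s.c + 1, x := s.c + 1, acc := 0, nz := 0 }.mem (opTime l) :=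
    exec_zero .nz (by simp) (hs .nz)
  have e5 : Exec (clear (.inl (.inl true)))
      { s with c := s.c + 1, x := s.c + 1, acc := 0, nz := 0 }.mem ()
      { s with c := s.c + 1, x := s.c + 1, acc := 0, nz := 0, out := [] }.mem
      (3 * s.out.length + 2) := by
    have := exec_clear_reg (s := { s with c := s.c + 1, x := s.c + 1, acc := 0, nz := 0 }.regs)
      (Sum.inl true)
    rw [Store.update_regs_out] at this
    exact this
  have e6 : (copy .cnt .m).Exec
      { s with c := s.c + 1, x := s.c + 1, acc := 0, nz := 0, out := [] }.mem ()
      { s with c := s.c + 1, x := s.c + 1, acc := 0, nz := 0, out := [], cnt := s.m }.mem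
      (opTime l) :=
    exec_copy .cnt .m (by simp) (by simp) (hs .cnt) (hs .m)
  refine ⟨x, y, d, r, t, Exec.mono (Exec.bind e1 (Exec.bind e2 (Exec.bind e3 (Exec.bind e4
    (Exec.bind e5 (Exec.bind e6 hex)))))) ?_, hb⟩
  have h2 : s.m * (l + 2) * 3 + 2 ≤ (s.m + 1) * opTime l := by
    unfold opTime
    nlinarith
  have h3 : (s.m + 1) * ((8 * l + 31) * opTime l) = (s.m + 1) * ((8 * l + 25) * opTime l) +
    (s.m + 1) * opTime l + 5 * ((s.m + 1) * opTime l) := by ring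
  have h4 : opTime l ≤ (s.m + 1) * opTime l := Nat.le_mul_of_pos_left _ (by omega)
  omega

/-- Try the next value of `c`, and exit if it is a solution. -/
def searchRound : Program (Unit ⊕ Unit) :=
  attempt.bind fun _ => (shift .acc).bind fun u => (shift .nz).bind fun v =>
    if u = none ∧ v ≠ none then ret (.inr ()) else ret (.inl ())

/-- Search for a solution `c`. -/
def search : Program Unit := iter (fun _ : Unit => searchRound) ()

open Classical in
theorem exec_searchRound {q : ℕ} [NeZero q] (hl : 2 * q ≤ 2 ^ l) (Θ : ZMod q)
    (hs : s.Bounded l) (hq : s.q = q) (hθ : s.θ = Θ.val) (hd : ∀ x, digit s.b.size s.e x ≤ q)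
    (hnz : s.m * q < 2 ^ l) (hc : s.c + 1 < 2 ^ l) (ho : s.out.length ≤ s.m * (l + 2)) :
    ∃ s' : Store, searchRound.Exec s.mem
        (if IsSolution Θ s.b.size s.e s.m (s.c + 1) then .inr () else .inl ()) s'.mem
        ((s.m + 1) * ((8 * l + 32) * opTime l)) ∧
      s'.Bounded l ∧ s'.inp = s.inp ∧ s'.q = s.q ∧ s'.θ = s.θ ∧ s'.m = s.m ∧ s'.b = s.b ∧
      s'.e = s.e ∧ s'.c = s.c + 1 ∧
      s'.out = writeAll (decode s.b.size s.e s.m (s.c + 1)) [] := by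
  obtain ⟨x, y, d, r, t, hex, hb⟩ := exec_attempt hl Θ hs hq hθ hd hnz hc ho
  -- A register is zero exactly if popping it yields nothing. The pops spoil `acc` and `nz`, which
  -- is harmless, as both are cleared at the next attempt.
  have hsol : IsSolution Θ s.b.size s.e s.m (s.c + 1) ↔
      (natStack (horner Θ 0 (decode s.b.size s.e s.m (s.c + 1))).val).head? = none ∧
      (natStack (absSum (decode s.b.size s.e s.m (s.c + 1)))).head? ≠ none := by
    rw [Ne, head?_natStack_eq_none, head?_natStack_eq_none, ZMod.val_eq_zero, IsSolution]
  generalize absSum (decode s.b.size s.e s.m (s.c + 1)) = N at hsol hex hb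
  generalize (horner Θ 0 (decode s.b.size s.e s.m (s.c + 1))).val = A at hsol hex hb
  generalize writeAll (decode s.b.size s.e s.m (s.c + 1)) [] = o at hex hb ⊢
  have h1 := exec_shift .acc (by simp) (s := { s with
    c := s.c + 1, x := x, y := y, d := d, r := r, t := t, cnt := 0, acc := A, nz := N, out := o })
  have h2 := exec_shift .nz (by simp) (s := { s with
    c := s.c + 1, x := x, y := y, d := d, r := r, t := t, cnt := 0, acc := A.div2, nz := N,
    out := o })
  simp only [Store.get, Store.set] at h1 h2
  refine ⟨{ s with
    c := s.c + 1, x := x, y := y, d := d, r := r, t := t, cnt := 0, acc := A.div2, nz := N.div2,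
    out := o }, Exec.mono (Exec.bind hex (Exec.bind h1 (Exec.bind (t₂ := 1) h2 ?_))) ?_, ?_, rfl,
    rfl, rfl, rfl, rfl, rfl, rfl, rfl⟩
  · by_cases h : IsSolution Θ s.b.size s.e s.m (s.c + 1)
    · rw [if_pos h, if_pos (hsol.1 h)]
      exact exec_ret _ _
    · rw [if_neg h, if_neg (fun h' => h (hsol.2 h'))]
      exact exec_ret _ _
  · have hW : 100 ≤ opTime l := by unfold opTime; omega
    nlinarith
  · have hA : A < 2 ^ l := hb .acc
    have hN : N < 2 ^ l := hb .nz
    have hA' : A.div2 < 2 ^ l := by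
      rw [Nat.div2_val]
      omega
    have hN' : N.div2 < 2 ^ l := by
      rw [Nat.div2_val]
      omega
    intro v
    cases v
    exacts [hb .one, hb .q, hb .m, hb .θ, hb .b, hb .e, hb .c, hb .x, hb .y, hb .d, hA', hb .r,
      hb .t, hN', hb .cnt]

/-- A known solution at `s.c + k + 1` only bounds the number of rounds. The search may stop earlier,
at another solution `c`, and its conclusion speaks about that one. -/
theorem exec_search {q : ℕ} [NeZero q] (hl : 2 * q ≤ 2 ^ l) (Θ : ZMod q) (k : ℕ) (s : Store)
    (hs : s.Bounded l) (hq : s.q = q) (hθ : s.θ = Θ.val) (hd : ∀ x, digit s.b.size s.e x ≤ q)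
    (hnz : s.m * q < 2 ^ l) (hc : s.c + k + 1 < 2 ^ l) (ho : s.out.length ≤ s.m * (l + 2))
    (hsol : IsSolution Θ s.b.size s.e s.m (s.c + k + 1)) :
    ∃ (c : ℕ) (s' : Store), IsSolution Θ s.b.size s.e s.m c ∧ s'.Bounded l ∧ s'.inp = s.inp ∧
      s'.out = writeAll (decode s.b.size s.e s.m c) [] ∧
      search.Exec s.mem () s'.mem ((k + 1) * ((s.m + 1) * ((8 * l + 32) * opTime l))) := by
  induction k generalizing s with
  | zero =>
    obtain ⟨s', hex, hb, hinp, -, -, -, -, -, -, hout⟩ :=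
      exec_searchRound hl Θ hs hq hθ hd hnz (by omega) ho
    rw [if_pos hsol] at hex
    exact ⟨s.c + 1, s', hsol, hb, hinp, hout, Exec.mono (Exec.iter_exit hex) (by simp)⟩
  | succ k ih =>
    obtain ⟨s', hex, hb, hinp, hq', hθ', hm', hb', he', hc', hout⟩ :=
      exec_searchRound hl Θ hs hq hθ hd hnz (by omega) ho
    by_cases hsol' : IsSolution Θ s.b.size s.e s.m (s.c + 1)
    · rw [if_pos hsol'] at hex
      exact ⟨s.c + 1, s', hsol', hb, hinp, hout, Exec.mono (Exec.iter_exit hex)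
        (Nat.le_mul_of_pos_left _ (by omega))⟩
    · rw [if_neg hsol'] at hex
      have hlen : s'.out.length ≤ s'.m * (l + 2) := by
        have hq1 : q < 2 ^ l := by
          have := Nat.pos_of_neZero q
          omega
        have := length_writeAll_le (l := l) (decode s.b.size s.e s.m (s.c + 1))
          (fun z hz => (natAbs_lt_of_mem_decode hd hz).trans_lt hq1) []
        rwa [length_decode, List.length_nil, add_zero, ← hout, ← hm'] at this
      have ih' := ih s' hb (hq'.trans hq) (hθ'.trans hθ) (by rwa [hb', he'])
        (by rwa [hm']) (by omega) hlen
        (by rwa [hb', he', hm', hc', show s.c + 1 + k + 1 = s.c + (k + 1) + 1 by omega])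
      rw [hb', he', hm', hinp] at ih'
      obtain ⟨c, s'', h1, h2, h3, h4, h5⟩ := ih'
      refine ⟨c, s'', h1, h2, h3, h4, Exec.mono (Exec.iter_next hex h5) ?_⟩
      rw [add_mul (k + 1) 1]
      omega

/-! #### The main program -/

/-- Empty the given variables. -/
def clearAll : List Var → Program Unit
  | [] => ret ()
  | a :: L => Frag.bind (clear (.inl (.inr a))) fun _ => clearAll L

/-- Stated for arbitrary register contents instead of a `Store`, because `one` is emptied too and
every `Store` has the value `1` there. -/
theorem exec_clearAll (L : List Var) (S : Reg → List (Option Bool))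
    (hS : ∀ a, (S (.inr a)).length ≤ l) :
    (clearAll L).Exec (mem S) () (mem (Sum.elim (fun i => S (.inl i))
      fun a => if a ∈ L then [] else S (.inr a))) (L.length * opTime l + 1) := by
  induction L generalizing S with
  | nil =>
    refine (exec_ret () _).congr_result ?_ |>.mono (by simp)
    congr 1
    funext r
    cases r <;> simp
  | cons a L ih =>
    have h := ih (Function.update S (.inr a) []) (fun v => by
      simp only [Function.update_apply]
      split_ifs
      exacts [by simp, hS v])
    refine Exec.mono (Exec.bind (exec_clear_reg (s := S) (Sum.inr a)) (h.congr_result ?_)) ?_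
    · congr 1
      funext r
      rcases r with i | v
      · simp
      · by_cases hva : v = a <;> simp [hva]
    · have := hS a
      rw [List.length_cons, add_mul]
      unfold opTime
      omega

/-- All variables. -/
def allVars : List Var :=
  [.one, .q, .m, .θ, .b, .e, .c, .x, .y, .d, .acc, .r, .t, .nz, .cnt]

/-- Read `q`, `m` and `θ`, compute `⌊q ^ (1 / m)⌋`, search for a solution, and leave nothing but
the output. -/
def main : Program Unit :=
  Frag.bind (push (.inl (.inr .one)) (some true)) fun _ =>
  Frag.bind (readNat (.inl false) (.inr .q)) fun _ =>
  Frag.bind (readNat (.inl false) (.inr .m)) fun _ =>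
  Frag.bind (readNat (.inl false) (.inr .θ)) fun _ =>
  rootB.bind fun _ => search.bind fun _ => clearAll allVars

theorem exec_main {q k N : ℕ} [NeZero q] (Θ : ZMod q) (hl : 2 * q + 3 < 2 ^ l)
    (hm : 2 ^ k * q < 2 ^ l) (hN : N + 1 < 2 ^ l)
    (hd : ∀ x, digit (Nat.sqrt^[k] q).size (Nat.sqrt^[k] q + 1) x ≤ q)
    (hsol : IsSolution Θ (Nat.sqrt^[k] q).size (Nat.sqrt^[k] q + 1) (2 ^ k) (N + 1)) :
    ∃ c, IsSolution Θ (Nat.sqrt^[k] q).size (Nat.sqrt^[k] q + 1) (2 ^ k) c ∧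
      main.Exec (Function.update (fun _ => []) (.inl (.inl false)) (encodeInput q (2 ^ k) Θ)) ()
        (Function.update (fun _ => []) (.inl (.inl true))
          (writeAll (decode (Nat.sqrt^[k] q).size (Nat.sqrt^[k] q + 1) (2 ^ k) c) []))
        ((k + 2) * ((q + 3) * (5 * opTime l)) +
          (N + 1) * ((2 ^ k + 1) * ((8 * l + 32) * opTime l)) + 20 * opTime l) := by
  have hv := Θ.val_lt
  have hq0 : 0 < q := Nat.pos_of_neZero q
  have h0 : 0 < 2 ^ l := by omega
  have h1 : 1 < 2 ^ l := by omega
  have hk : 2 ^ k < 2 ^ l := (Nat.le_mul_of_pos_right _ hq0).trans_lt hm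
  have hql : q < 2 ^ l := by omega
  have hΘl : Θ.val < 2 ^ l := by omega
  set s₀ : Store := ⟨encodeInput q (2 ^ k) Θ, [], 0, 0, 0, 0, 0, 0, 0, 0, 0, 0, 0, 0, 0, 0⟩ with hs₀
  have hi : s₀.inp = encodeNatBin q ++ (encodeNatBin (2 ^ k) ++ (encodeNatBin Θ.val ++ [])) := by
    simp [hs₀, encodeInput]
  set s₁ : Store := { s₀ with
    inp := encodeNatBin (2 ^ k) ++ (encodeNatBin Θ.val ++ []), q := q } with hs₁
  set s₂ : Store := { s₁ with inp := encodeNatBin Θ.val ++ [], m := 2 ^ k } with hs₂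
  set s₃ : Store := { s₂ with inp := [], θ := Θ.val } with hs₃
  have e0 : (push (.inl (.inr .one)) (some true) : Program Unit).Exec
      (Function.update (fun _ => []) (.inl (.inl false)) (encodeInput q (2 ^ k) Θ)) ()
      s₀.mem 1 := by
    refine (exec_push _ _ _).congr_result ?_
    funext r
    rcases r with ((_ | _) | v) | i
    · simp [hs₀, Store.mem, mem, Store.regs]
    · simp [hs₀, Store.mem, mem, Store.regs]
    · cases v <;> simp [hs₀, Store.mem, mem, Store.regs, Store.get, natStack_one]
    · fin_cases i <;> simp [Store.mem, mem]
  have e1 := exec_read (s := s₀) .q (by simp) hql hi rfl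
  have e2 := exec_read (s := s₁) .m (by simp) hk rfl rfl
  have e3 := exec_read (s := s₂) .θ (by simp) hΘl rfl rfl
  have hb₃ : s₃.Bounded l := by
    intro v
    cases v
    exacts [h1, hql, hk, hΘl, h0, h0, h0, h0, h0, h0, h0, h0, h0, h0, h0]
  obtain ⟨x, t, e4, hb₄⟩ := exec_rootB hb₃ (k := k) rfl hl
  -- The counter starts at `0` and is increased before each test, so the first candidate is `1`.
  obtain ⟨c, s', hc, hb', hinp, hout, e5⟩ := exec_search (by omega) Θ N _ hb₄ rfl rfl hd hm
    (by change 0 + N + 1 < _; omega) (Nat.zero_le _)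
    (by change IsSolution _ _ _ _ (0 + N + 1); rwa [zero_add])
  have e6 := exec_clearAll (l := l) allVars s'.regs (fun a => length_natStack_le (hb' a))
  refine ⟨c, hc, Exec.mono (Exec.bind e0 (Exec.bind e1 (Exec.bind e2 (Exec.bind e3 (Exec.bind e4
    (Exec.bind e5 (e6.congr_result ?_))))))) ?_⟩
  · funext r
    rcases r with ((_ | _) | v) | i
    · simp [mem, Store.regs, hinp, hs₃]
    · simp [mem, Store.regs, hout, hs₃, hs₂, hs₁]
    · cases v <;> simp [mem, allVars]
    · fin_cases i <;> simp [mem]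
  · have hW : 100 ≤ opTime l := by unfold opTime; omega
    have : allVars.length = 15 := rfl
    rw [this]
    change 1 + (opTime l + (opTime l + (opTime l + ((k + 2) * ((q + 3) * (5 * opTime l)) +
      ((N + 1) * ((2 ^ k + 1) * ((8 * l + 32) * opTime l)) + (15 * opTime l + 1)))))) ≤ _
    omega

end Program

/-! ### Short vectors -/

/-- With `lt_iterate_sqrt_succ_pow` this identifies the iterated integer root `B` as the integer
part of `q ^ (1 / 2 ^ k)`: nested rounding loses nothing. The present half gives the norm bound, the
other one the pigeonhole count. -/
theorem iterate_sqrt_pow_le (k q : ℕ) : (Nat.sqrt^[k] q) ^ 2 ^ k ≤ q := by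
  induction k generalizing q with
  | zero => simp
  | succ k ih =>
    rw [Function.iterate_succ_apply, pow_succ 2, pow_mul]
    exact (Nat.pow_le_pow_left (ih _) 2).trans (Nat.sqrt_le' q)

theorem lt_iterate_sqrt_succ_pow (k q : ℕ) : q < (Nat.sqrt^[k] q + 1) ^ 2 ^ k := by
  induction k generalizing q with
  | zero => simp
  | succ k ih =>
    rw [Function.iterate_succ_apply, pow_succ 2, pow_mul]
    exact (Nat.lt_succ_sqrt' q).trans_le (Nat.pow_le_pow_left (ih _) 2)

theorem iterate_sqrt_pos (k : ℕ) {q : ℕ} (hq : 0 < q) : 0 < Nat.sqrt^[k] q := by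
  induction k generalizing q with
  | zero => simpa
  | succ k ih => exact ih (Nat.sqrt_pos.2 hq)

theorem two_pow_size_le {B : ℕ} (hB : 0 < B) : 2 ^ B.size ≤ 2 * B := by
  have h := Nat.size_pos.2 hB
  obtain ⟨n, hn⟩ := Nat.exists_eq_succ_of_ne_zero h.ne'
  have := Nat.lt_size.1 (show n < B.size by omega)
  rw [hn, pow_succ]
  omega

/-- A block of `B.size` bits is below `2 ^ B.size ≤ 2 * B`, so subtracting `B + 1` at most once
brings it into range. Thus every candidate satisfies the norm bound and the program need not check
it. -/
theorem digit_le {B : ℕ} (hB : 0 < B) (x : ℕ) : digit B.size (B + 1) x ≤ B := by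
  have h := takeBits_fst_lt B.size 0 x
  have := two_pow_size_le hB
  unfold digit
  split_ifs <;> omega

/-- Each coefficient takes one sign bit and `L` bits of absolute value. As `|z| < e ≤ 2 ^ L`, the
block can hold the absolute value itself, and no reduction by `e` takes place. -/
theorem exists_decode_eq (L e : ℕ) (he : e ≤ 2 ^ L) (zs : List ℤ) (h : ∀ z ∈ zs, z.natAbs < e) :
    ∃ c < 2 ^ ((L + 1) * zs.length), decode L e zs.length c = zs := by
  induction zs with
  | nil => exact ⟨0, by simp, rfl⟩
  | cons z zs ih =>
    obtain ⟨c, hc, hdec⟩ := ih fun z hz => h z (List.mem_cons_of_mem _ hz)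
    have hz := h z List.mem_cons_self
    obtain ⟨y, hy, hlt⟩ := exists_takeBits_eq L 0 z.natAbs c (hz.trans_le he)
    refine ⟨Nat.bit (decide (z < 0)) y, ?_, ?_⟩
    · have h1 : 2 ^ L * (c + 1) ≤ 2 ^ L * 2 ^ ((L + 1) * zs.length) := Nat.mul_le_mul_left _ hc
      have h2 : 2 ^ ((L + 1) * (z :: zs).length) = 2 * (2 ^ L * 2 ^ ((L + 1) * zs.length)) := by
        rw [List.length_cons]
        ring
      rw [h2, Nat.bit_val]
      have := Bool.toNat_le (decide (z < 0))
      omega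
    · rw [mul_zero, zero_add] at hy
      rw [List.length_cons, decode, nextDigit, restDigits, Nat.bodd_bit, Nat.div2_bit, digit, hy,
        if_neg (not_le.2 hz), hdec]
      congr 1
      unfold signed
      split_ifs with hneg
      · have := of_decide_eq_true hneg
        omega
      · have := of_decide_eq_false (eq_false_of_ne_true hneg)
        omega

theorem absSum_eq_zero_iff {zs : List ℤ} : absSum zs = 0 ↔ ∀ z ∈ zs, z = 0 := by
  induction zs with
  | nil => simp [absSum]
  | cons z zs ih =>
    simp only [absSum] at ih
    simp [absSum, ih]

/-- The number `0` codes the zero vector, so a search that starts at `1` misses no solution. -/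
theorem absSum_decode_zero (L n : ℕ) {e : ℕ} (he : 0 < e) : absSum (decode L e n 0) = 0 := by
  have ht : takeBits L (0, 0) = (0, 0) := Function.iterate_fixed rfl L
  induction n with
  | zero => rfl
  | succ n ih =>
    have h1 : nextDigit L e 0 = 0 := by
      simp [nextDigit, digit, ht, he.ne', signed]
    have h2 : restDigits L 0 = 0 := by simp [restDigits, ht]
    rw [decode, h1, h2]
    simpa [absSum] using ih

theorem horner_ofFn_sub {R : Type*} [CommRing R] (x : R) {n : ℕ} (f g : Fin n → ℤ) (A A' : R) :
    horner x (A - A') (List.ofFn fun i => f i - g i) =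
      horner x A (List.ofFn f) - horner x A' (List.ofFn g) := by
  induction n generalizing A A' with
  | zero => simp [horner]
  | succ n ih =>
    have := ih (fun i => f i.succ) (fun i => g i.succ) (A * x + f 0) (A' * x + g 0)
    simp only [List.ofFn_succ, horner, List.foldl_cons] at this ⊢
    rw [← this]
    congr 1
    push_cast
    ring

/-- Pigeonhole principle: there is a nonzero list of small integers on which Horner's rule yields
zero. -/
theorem exists_short_list {q : ℕ} [NeZero q] (Θ : ZMod q) {m B : ℕ} (h : q < (B + 1) ^ m) :
    ∃ zs : List ℤ, zs.length = m ∧ (∀ z ∈ zs, z.natAbs < B + 1) ∧ horner Θ 0 zs = 0 ∧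
      absSum zs ≠ 0 := by
  -- There are `(B + 1) ^ m` functions and only `q` residues. The entries of `f` and `g` lie between
  -- `0` and `B`, so their differences have absolute value at most `B`.
  obtain ⟨f, g, hne, hfg⟩ := Fintype.exists_ne_map_eq_of_card_lt
    (fun f : Fin m → Fin (B + 1) => horner Θ 0 (List.ofFn fun i => ((f i : ℕ) : ℤ)))
    (by simpa [ZMod.card] using h)
  refine ⟨List.ofFn fun i => ((f i : ℕ) : ℤ) - ((g i : ℕ) : ℤ), by simp, ?_, ?_, ?_⟩
  · intro z hz
    obtain ⟨i, rfl⟩ := (List.mem_ofFn' _ _).1 hz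
    have h1 := (f i).isLt
    have h2 := (g i).isLt
    dsimp only
    omega
  · have := horner_ofFn_sub Θ (fun i => ((f i : ℕ) : ℤ)) (fun i => ((g i : ℕ) : ℤ)) 0 0
    rw [sub_zero] at this
    rw [this]
    exact sub_eq_zero.2 hfg
  · rw [Ne, absSum_eq_zero_iff]
    intro h0
    refine hne (funext fun i => Fin.ext ?_)
    have := h0 _ ((List.mem_ofFn' _ _).2 ⟨i, rfl⟩)
    dsimp only at this
    omega

theorem exists_isSolution {q : ℕ} [NeZero q] (Θ : ZMod q) (k : ℕ) :
    ∃ N, N + 1 ≤ 4 ^ 2 ^ k * q ∧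
      IsSolution Θ (Nat.sqrt^[k] q).size (Nat.sqrt^[k] q + 1) (2 ^ k) (N + 1) := by
  have hB := iterate_sqrt_pos k (Nat.pos_of_neZero q)
  have hBq := iterate_sqrt_pow_le k q
  obtain ⟨zs, hlen, hz, hzero, habs⟩ := exists_short_list Θ (lt_iterate_sqrt_succ_pow k q)
  generalize Nat.sqrt^[k] q = B at *
  obtain ⟨c, hc, hdec⟩ := exists_decode_eq B.size (B + 1) (Nat.lt_size_self B) zs hz
  rw [hlen] at hc hdec
  have hc0 : c ≠ 0 := by
    rintro rfl
    rw [← hdec] at habs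
    exact habs (absSum_decode_zero _ _ (by omega))
  obtain ⟨N, rfl⟩ := Nat.exists_eq_succ_of_ne_zero hc0
  refine ⟨N, ?_, (congrArg (horner Θ 0) hdec).trans hzero, fun h0 => habs (hdec ▸ h0)⟩
  -- Per coefficient the coding loses a factor `2` for the sign and at most `2` for rounding `B` up
  -- to a power of two; this is the origin of `4 ^ m`.
  calc N + 1 ≤ 2 ^ ((B.size + 1) * 2 ^ k) := hc.le
    _ = (2 * 2 ^ B.size) ^ 2 ^ k := by rw [pow_mul, pow_succ, mul_comm]
    _ ≤ (4 * B) ^ 2 ^ k := Nat.pow_le_pow_left (by have := two_pow_size_le hB; omega) _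
    _ = 4 ^ 2 ^ k * B ^ 2 ^ k := mul_pow _ _ _
    _ ≤ 4 ^ 2 ^ k * q := Nat.mul_le_mul_left _ hBq

/-! ### Elements of `ℤ[y]/(y ^ m + 1)` given by lists -/

theorem horner_append {R : Type*} [CommRing R] (x A : R) (zs : List ℤ) (z : ℤ) :
    horner x A (zs ++ [z]) = horner x A zs * x + z := by
  simp [horner]

theorem map_horner {R S : Type*} [CommRing R] [CommRing S] (f : R →+* S) (x : R) (zs : List ℤ) :
    f (horner x 0 zs) = horner (f x) 0 zs := by
  induction zs using List.reverseRecOn with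
  | nil => simp [horner]
  | append_singleton zs z ih => simp [horner_append, ih]

theorem coeff_horner (zs : List ℤ) (i : ℕ) :
    (horner (X : ℤ[X]) 0 zs).coeff i = zs.reverse.getD i 0 := by
  induction zs using List.reverseRecOn generalizing i with
  | nil => simp [horner]
  | append_singleton zs z ih =>
    rw [horner_append, coeff_add, ← eq_intCast (C : ℤ →+* ℤ[X]), coeff_C]
    cases i with
    | zero => simp
    | succ i => simp [ih]

theorem degree_horner_lt (zs : List ℤ) : (horner (X : ℤ[X]) 0 zs).degree < zs.length := by
  rw [degree_lt_iff_coeff_zero]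
  intro i hi
  rw [coeff_horner, List.getD_eq_default _ _ (by simpa using hi)]

namespace NegacyclicRing

/-- The element with given coefficients, the highest one first. -/
noncomputable def ofList (m : ℕ) (zs : List ℤ) : NegacyclicRing m :=
  horner (AdjoinRoot.root (X ^ m + 1 : ℤ[X])) 0 zs

theorem evalAt_ofList {m q : ℕ} {θ : ZMod q} (hθ : θ ^ m = -1) (zs : List ℤ) :
    evalAt θ hθ (ofList m zs) = horner θ 0 zs := by
  rw [ofList, map_horner, evalAt, AdjoinRoot.lift_root]

variable {m : ℕ} [NeZero m]

/-- The Horner polynomial of a list of length `m` has degree less than `m`, so it is its own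
remainder modulo `X ^ m + 1`. -/
theorem coeff_ofList {zs : List ℤ} (h : zs.length = m) (i : ℕ) :
    (ofList m zs).coeff i = zs.reverse.getD i 0 := by
  have h1 : ofList m zs = AdjoinRoot.mk (X ^ m + 1 : ℤ[X]) (horner X 0 zs) := by
    rw [map_horner, AdjoinRoot.mk_X]
    rfl
  rw [coeff, h1, AdjoinRoot.modByMonicHom_mk, (modByMonic_eq_self_iff
    (monic_X_pow_add_one_int m)).2, coeff_horner]
  refine (degree_horner_lt zs).trans_le ?_
  rw [h, ← C_1, degree_X_pow_add_C (NeZero.pos m)]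

theorem maxNorm_ofList_le {zs : List ℤ} (h : zs.length = m) {B : ℕ}
    (hB : ∀ z ∈ zs, z.natAbs ≤ B) : (ofList m zs).maxNorm ≤ B := by
  refine Finset.sup_le fun i hi => ?_
  rw [coeff_ofList h, List.getD_eq_getElem _ _ (by simpa [h] using hi)]
  exact hB _ (List.mem_reverse.1 (List.getElem_mem _))

theorem ofList_ne_zero {zs : List ℤ} (h : zs.length = m) (h0 : absSum zs ≠ 0) :
    ofList m zs ≠ 0 := by
  intro hz
  refine h0 (absSum_eq_zero_iff.2 fun z hmem => ?_)
  obtain ⟨i, hi, rfl⟩ := List.getElem_of_mem (List.mem_reverse.2 hmem)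
  rw [← List.getD_eq_getElem _ 0, ← coeff_ofList h, hz]
  simp [coeff]

theorem writeAll_eq (zs : List ℤ) (o : List (Option Bool)) :
    writeAll zs o = zs.reverse.flatMap encodeIntBin ++ o := by
  induction zs generalizing o with
  | nil => simp [writeAll]
  | cons z zs ih =>
    change writeAll zs (encodeIntBin z ++ o) = _
    rw [ih]
    simp

theorem encodeElem_ofList {zs : List ℤ} (h : zs.length = m) :
    encodeElem (ofList m zs) = writeAll zs [] := by
  have h1 : (List.range m).map (fun i => zs.reverse.getD i 0) = zs.reverse := by
    refine List.ext_getElem (by simp [h]) fun i h1 h2 => ?_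
    simp only [List.getElem_map, List.getElem_range]
    exact List.getD_eq_getElem _ _ h2
  rw [writeAll_eq, List.append_nil, ← h1, List.flatMap_map, encodeElem]
  simp only [coeff_ofList h]

end NegacyclicRing

/-! ### Running time -/

theorem logb_le_lg {n : ℕ} (hn : n ≠ 1) : Real.logb 2 n ≤ lg n := by
  rw [lg, if_neg hn]
  exact Nat.le_ceil _

theorem tendsto_lg : Tendsto lg atTop atTop := by
  have h : Tendsto (fun n : ℕ => Real.logb 2 n) atTop atTop :=
    (Real.tendsto_logb_atTop (by norm_num)).comp tendsto_natCast_atTop_atTop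
  rw [← tendsto_natCast_atTop_iff (R := ℝ)]
  refine tendsto_atTop_mono' _ ?_ h
  filter_upwards [eventually_ne_atTop 1] with n hn using logb_le_lg hn

/-- The exponent `ε` in the bound `q ^ (1 + ε q)` for the running time. -/
noncomputable def timeExponent (q : ℕ) : ℝ :=
  2 / (lg (lg q) : ℝ) ^ 2 + (Real.log 6400000 + 3 * Real.log (Real.log q)) / Real.log q

theorem tendsto_timeExponent : Tendsto timeExponent atTop (𝓝 0) := by
  have h1 : Tendsto (fun q : ℕ => 2 / (lg (lg q) : ℝ) ^ 2) atTop (𝓝 0) := by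
    refine Tendsto.const_div_atTop ?_ 2
    exact (tendsto_pow_atTop two_ne_zero).comp
      (tendsto_natCast_atTop_atTop.comp (tendsto_lg.comp tendsto_lg))
  have h2 : Tendsto (fun x : ℝ => (Real.log 6400000 + 3 * Real.log x) / x) atTop (𝓝 0) := by
    have ha : Tendsto (fun x : ℝ => Real.log 6400000 / x) atTop (𝓝 0) :=
      tendsto_id.const_div_atTop _
    have hb : Tendsto (fun x : ℝ => Real.log x / x) atTop (𝓝 0) :=
      Real.isLittleO_log_id_atTop.tendsto_div_nhds_zero
    have := ha.add (hb.const_mul 3)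
    rw [mul_zero, add_zero] at this
    refine this.congr fun x => ?_
    ring
  have h3 : Tendsto (fun q : ℕ => Real.log q) atTop atTop :=
    Real.tendsto_log_atTop.comp tendsto_natCast_atTop_atTop
  have := h1.add (h2.comp h3)
  rw [add_zero] at this
  exact this

theorem size_le_four_mul_log {q : ℕ} (hq : 2 ≤ q) : (q.size : ℝ) ≤ 4 * Real.log q := by
  have hq' : (2 : ℝ) ≤ q := by exact_mod_cast hq
  have h1 : 2 ^ (q.size - 1) ≤ q := by
    refine Nat.lt_size.1 ?_
    have := Nat.size_pos.2 (show 0 < q by omega)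
    omega
  have h2 : ((q.size - 1 : ℕ) : ℝ) * Real.log 2 ≤ Real.log q := by
    rw [← Real.log_pow]
    exact Real.log_le_log (by positivity) (by exact_mod_cast h1)
  have h3 : Real.log 2 ≤ Real.log q := Real.log_le_log (by norm_num) hq'
  have h4 : (q.size : ℝ) ≤ (q.size - 1 : ℕ) + 1 := by
    exact_mod_cast (show q.size ≤ q.size - 1 + 1 by omega)
  have h5 := Real.log_two_gt_d9
  have h6 : (0 : ℝ) ≤ (q.size - 1 : ℕ) := by positivity
  nlinarith

/-- The first summand of `timeExponent` pays for `4 ^ m = 2 ^ (2 * m)` through the hypothesis on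
`m`. The second turns the remaining factor into a power of `q`: since `q.size ≤ 4 * log q`, it is at
most `100000 * (4 * log q) ^ 3 = 6400000 * (log q) ^ 3`. -/
theorem four_pow_mul_size_le {q m : ℕ} (hq : 2 ≤ q)
    (hm : (m : ℝ) ≤ Real.logb 2 q / (lg (lg q) : ℝ) ^ 2) :
    ((100000 * (4 ^ m * q * q.size ^ 3) : ℕ) : ℝ) ≤ (q : ℝ) ^ (1 + timeExponent q) := by
  have hq' : (2 : ℝ) ≤ q := by exact_mod_cast hq
  have hq0 : (0 : ℝ) < q := by linarith
  have hlog : 0 < Real.log q := Real.log_pos (by linarith)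
  have hsize := size_le_four_mul_log hq
  have h4 : (4 : ℝ) ^ m ≤ (q : ℝ) ^ (2 / (lg (lg q) : ℝ) ^ 2) := by
    have e : (4 : ℝ) ^ m = (2 : ℝ) ^ (2 * (m : ℝ)) := by
      rw [Real.rpow_mul (by norm_num), Real.rpow_natCast]
      norm_num
    have e2 : (q : ℝ) = (2 : ℝ) ^ Real.logb 2 q :=
      (Real.rpow_logb (by norm_num) (by norm_num) hq0).symm
    rw [e]
    nth_rw 1 [e2]
    rw [← Real.rpow_mul (by norm_num)]
    refine Real.rpow_le_rpow_of_exponent_le (by norm_num) ?_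
    calc 2 * (m : ℝ) ≤ 2 * (Real.logb 2 q / (lg (lg q) : ℝ) ^ 2) := by linarith
      _ = _ := by ring
  have hC : (q : ℝ) ^ ((Real.log 6400000 + 3 * Real.log (Real.log q)) / Real.log q) =
      6400000 * Real.log q ^ 3 := by
    rw [Real.rpow_def_of_pos hq0, mul_div_cancel₀ _ hlog.ne', Real.exp_add,
      Real.exp_log (by norm_num), ← Real.exp_log (pow_pos hlog 3), Real.log_pow]
    simp
  rw [timeExponent, ← add_assoc, Real.rpow_add hq0, Real.rpow_add hq0, hC, Real.rpow_one]
  push_cast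
  have h3 : (q.size : ℝ) ^ 3 ≤ (4 * Real.log q) ^ 3 := pow_le_pow_left₀ (by positivity) hsize 3
  calc (100000 : ℝ) * (4 ^ m * q * (q.size : ℝ) ^ 3)
      ≤ 100000 * ((q : ℝ) ^ (2 / (lg (lg q) : ℝ) ^ 2) * q * (4 * Real.log q) ^ 3) := by gcongr
    _ = _ := by ring

/-- A crude consequence of the hypothesis on `m`, used to bound the register lengths and to compare
`m` with `q.size`; the running time needs the full strength of that hypothesis. -/
theorem two_pow_le_of_le_logb {q m : ℕ} [NeZero m] (hq : 2 ≤ q)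
    (hm : (m : ℝ) ≤ Real.logb 2 q / (lg (lg q) : ℝ) ^ 2) : 2 ^ m ≤ q := by
  have hq' : (2 : ℝ) ≤ q := by exact_mod_cast hq
  have hlog : 0 ≤ Real.logb 2 q := Real.logb_nonneg (by norm_num) (by linarith)
  -- If the denominator were zero, the quotient would be `0` by convention, and `m ≤ 0` is excluded.
  have h0 : lg (lg q) ≠ 0 := by
    intro h
    rw [h] at hm
    norm_num at hm
    exact NeZero.ne m hm
  have h1 : (1 : ℝ) ≤ (lg (lg q) : ℝ) ^ 2 := by
    have : (1 : ℝ) ≤ lg (lg q) := by exact_mod_cast Nat.one_le_iff_ne_zero.2 h0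
    nlinarith
  have h2 : (m : ℝ) ≤ Real.logb 2 q := hm.trans (div_le_self hlog h1)
  rw [Real.le_logb_iff_rpow_le (by norm_num) (by linarith), Real.rpow_natCast] at h2
  exact_mod_cast h2

theorem total_time_le {q k N S : ℕ} (hN : N + 1 ≤ 4 ^ 2 ^ k * q) (hS : 2 ≤ S) (hq : 2 ≤ q)
    (hk : 2 ^ k ≤ S) :
    (k + 2) * ((q + 3) * (5 * Frag.opTime (3 * S + 3))) +
      (N + 1) * ((2 ^ k + 1) * ((8 * (3 * S + 3) + 32) * Frag.opTime (3 * S + 3))) +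
      20 * Frag.opTime (3 * S + 3) ≤ 100000 * (4 ^ 2 ^ k * q * S ^ 3) := by
  have hk' : k < 2 ^ k := Nat.lt_two_pow_self
  have hW : Frag.opTime (3 * S + 3) ≤ 500 * S := by unfold Frag.opTime; omega
  have hE : q ≤ 4 ^ 2 ^ k * q := Nat.le_mul_of_pos_left _ (by positivity)
  generalize 4 ^ 2 ^ k * q = E at *
  generalize 2 ^ k = M at *
  generalize Frag.opTime (3 * S + 3) = W at *
  -- With `k < M ≤ S`, `2 ≤ q ≤ E` and `2 ≤ S`, the three summands are at most `15000 * E * S ^ 2`,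
  -- `52000 * E * S ^ 3` and `10000 * S`, which together stay below `100000 * E * S ^ 3`.
  have h1 : (k + 2) * ((q + 3) * (5 * W)) ≤ (2 * S) * ((3 * E) * (5 * (500 * S))) := by
    gcongr <;> omega
  have h2 : (N + 1) * ((M + 1) * ((8 * (3 * S + 3) + 32) * W)) ≤
      E * ((2 * S) * ((52 * S) * (500 * S))) := by
    gcongr <;> omega
  have h3 : 20 * W ≤ 20 * (500 * S) := by gcongr
  have h4 : E * S ^ 2 ≤ E * S ^ 3 := by gcongr <;> omega
  have h5 : S ≤ E * S ^ 3 := by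
    calc S = 1 * S ^ 1 := by ring
      _ ≤ E * S ^ 3 := by gcongr <;> omega
  nlinarith

/-- The machine that searches for a short vector. -/
noncomputable def searchMachine : TapeMachine (Option Bool) :=
  Program.main.toTapeMachine (.inl (.inl false)) (.inl (.inl true))

theorem mainTheorem8 :
    ∃ (M : TapeMachine (Option Bool)) (ε : ℕ → ℝ), Tendsto ε atTop (𝓝 0) ∧
      ∀ (q m : ℕ) [NeZero m] (θ : ZMod q) (hθ : θ ^ m = -1),
        2 ≤ q → (∃ k : ℕ, m = 2 ^ k) →
        (m : ℝ) ≤ Real.logb 2 (q : ℝ) / (lg (lg q) : ℝ) ^ 2 →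
        ∃ P : NegacyclicRing m,
          P ≠ 0 ∧
          NegacyclicRing.evalAt θ hθ P = 0 ∧
          (P.maxNorm : ℝ) ≤ (q : ℝ) ^ (1 / (m : ℝ)) ∧
          ∃ t : ℕ, (t : ℝ) ≤ (q : ℝ) ^ (1 + ε q) ∧
            M.OutputsWithin (encodeInput q m θ) (encodeElem P) t := by
  refine ⟨searchMachine, timeExponent, tendsto_timeExponent, ?_⟩
  rintro q m _ θ hθ hq ⟨k, rfl⟩ hm
  have : NeZero q := ⟨by omega⟩
  have hB := iterate_sqrt_pos k (show 0 < q by omega)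
  have hBq := iterate_sqrt_pow_le k q
  have h2m := two_pow_le_of_le_logb hq hm
  have hqS := Nat.lt_size_self q
  have hS : 2 ≤ q.size := Nat.lt_size.2 (by simpa using hq)
  have hmS : 2 ^ k ≤ q.size := (Nat.pow_le_pow_iff_right (by norm_num : 1 < 2)).1 (h2m.trans hqS.le)
  obtain ⟨N, hN, hsol⟩ := exists_isSolution θ k
  have h4m : 4 ^ 2 ^ k ≤ q * q := by
    rw [show (4 : ℕ) = 2 * 2 by norm_num, mul_pow]
    exact Nat.mul_le_mul h2m h2m
  -- The word length `3 * q.size + 3` is chosen so that the candidates, at most `4 ^ m * q ≤ q ^ 3`,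
  -- fit into a register; the extra `3` leaves room for `2 * q + 3`.
  have hpow : q * q * q < 2 ^ (3 * q.size + 3) := by
    calc q * q * q < 2 ^ q.size * 2 ^ q.size * 2 ^ q.size := by gcongr
      _ = 2 ^ (3 * q.size) := by ring
      _ ≤ 2 ^ (3 * q.size + 3) := Nat.pow_le_pow_right (by norm_num) (by omega)
  have hl : 2 * q + 3 < 2 ^ (3 * q.size + 3) := by
    calc 2 * q + 3 < 2 ^ q.size * 8 := by omega
      _ = 2 ^ (q.size + 3) := by ring
      _ ≤ 2 ^ (3 * q.size + 3) := Nat.pow_le_pow_right (by norm_num) (by omega)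
  have hmq : 2 ^ k * q < 2 ^ (3 * q.size + 3) := by
    have : 2 ^ k < 2 ^ 2 ^ k := Nat.lt_two_pow_self
    nlinarith [Nat.mul_le_mul_right q (this.le.trans h2m)]
  have hNl : N + 1 < 2 ^ (3 * q.size + 3) :=
    (hN.trans (Nat.mul_le_mul_right q h4m)).trans_lt hpow
  have hBq' := Program.iterate_sqrt_le k q
  obtain ⟨c, ⟨hc1, hc2⟩, hex⟩ := Program.exec_main θ hl hmq hNl
    (fun x => (digit_le hB x).trans hBq') hsol
  set zs := decode (Nat.sqrt^[k] q).size (Nat.sqrt^[k] q + 1) (2 ^ k) c with hzs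
  have hlen : zs.length = 2 ^ k := length_decode _ _ _ _
  have hout := hex.outputsWithin
  rw [← NegacyclicRing.encodeElem_ofList hlen] at hout
  refine ⟨NegacyclicRing.ofList _ zs, NegacyclicRing.ofList_ne_zero hlen hc2,
    (NegacyclicRing.evalAt_ofList hθ zs).trans hc1, ?_, _,
    ?_, hout⟩
  -- The norm bound comes from the decoding and therefore holds for whichever solution the search
  -- has found, not just for the one supplied by the pigeonhole principle.
  · have h1 := NegacyclicRing.maxNorm_ofList_le hlen
      (fun z hz => natAbs_lt_of_mem_decode (digit_le hB) hz)
    have h2 : ((NegacyclicRing.ofList (2 ^ k) zs).maxNorm : ℝ) ≤ (Nat.sqrt^[k] q : ℕ) := by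
      exact_mod_cast h1
    refine h2.trans ?_
    rw [one_div, Real.le_rpow_inv_iff_of_pos (by positivity) (by positivity) (by positivity),
      Real.rpow_natCast]
    exact_mod_cast hBq
  · refine le_trans ?_ (four_pow_mul_size_le hq hm)
    exact_mod_cast total_time_le hN hS hq hmS
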